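/- \textbf{Notation.} $S_\infty$ is the group of permutations of $\{1,2,3,\dots\}$ moving finitely many points, $S_p\subset S_\infty$, and $t_{ij}$ is the transposition of $i,j$. For $w\in S_p$ and $v\in S_\infty$, $w\times v\in S_\infty$ is given by $(w\times v)(i)=w(i)$ for $i\le p$ and $(w\times v)(p+i)=p+v(i)$; $1^n$ is the identity of $S_n$. The code of $w$ is $c(w)=(c_1,c_2,\dots)$ with $c_i=\#\{j>i: w(j)<w(i)\}$; $\ell(c(w))=\max\{i: c_i\ne0\}$ ($0$ if $w$ is the identity), and $\ell(w)=\sum_i c_i$. The diagram $D(w)$ has a box in row $i$ and column $w(k)$ for each $i<k$ with $w(k)<w(i)$. A permutation is Grassmannian if it has at most one descent. The Schubert polynomial is $\mathfrak S_w=\sum x_{i_1}\cdots x_{i_\ell}$, summed over all reduced words $a_1\cdots a_\ell$ of $w$ and all $i_1\le\dots\le i_\ell$ with $i_j\le a_j$, and $i_j<i_{j+1}$ whenever $a_j<a_{j+1}$; the Stanley symmetric function is the coefficientwise limit $F_w=\lim_{n\to\infty}\mathfrak S_{1^n\times w}$. \textbf{Canonical expansion.} Given $w,u$, write $\mathfrak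 S_{1^i\times w}\,\mathfrak S_{1^i\times u}=\sum_{v\in S_\infty}c_i(v)\,\mathfrak S_v$ for $i\ge0$. Let $V_0=\{v: c_0(v)\ne0\}$ and, for $i\ge1$, let $V_i$ be the set of $v$ with $c_i(v)\neq0$ that are not of the form $1\times v'$ with $c_{i-1}(v')\ne0$. For $v\in V_i$ put $c_{wu}^v=c_i(v)$. With $k=\ell(w)+\ell(u)$, the canonical expansion of $F_wF_u$ is $\sum_{i=0}^{k}\sum_{v\in V_i}c_{wu}^vF_v$. \textbf{MT-moves.} Let $x\in S_\infty$ have a descent, let $r$ be its largest descent and $s$ the largest integer with $x(s)<x(r)$. An MT-move replaces $x$ (and $D(x)$) by $y=xt_{rs}t_{jr}$ (and $D(y)$) for some $j<r$ with $\ell(y)=\ell(x)$. \textbf{Statement.} Let $w\in S_p$ and $u\in S_q$ with $\ell(c(w))=\ell(c(u))=m$ and $u$ Grassmannian. Apply MT-moves successively, in all possible ways, to $D(1^m\times w\times u)$, stopping at a diagram as soon as all its boxes lie in the first $2m$ rows (or if no MT-move is possible), and let $A$ be the multiset of final diagrams, one for each complete sequence of moves. Then $F_wF_u=\sum_{i=0}^{k}\sum_{v\in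 V_i}c_{wu}^vF_v$, and for all $0\le i\le k$ and $v\in V_i$ one has $i\le m$ and $$c_{wu}^v=\#\{D\in A\mid D=D(1^{m-i}\times v)\},$$ this number being finite. Moreover every $D\in A$ equals $D(1^{m-i}\times v)$ for some $0\le i\le\min(k,m)$ and $v\in V_i$. -/

import Mathlib

/-! Conventions.  Rows, columns, positions, values and variable indices are numbered from `0`:
position (row, variable, ...) `i` here is position `i + 1` in the usual one-based notation. -/

/-- The group `S_∞` of permutations of `ℕ` that move only finitely many points. -/
def SInf : Subgroup (Equiv.Perm ℕ) where
  carrier := {w | {i | w i ≠ i}.Finite}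
  one_mem' := by simp
  mul_mem' := by
    intro a b ha hb
    refine (Set.Finite.union ha hb).subset ?_
    intro i hi
    by_contra h
    simp only [Set.mem_union, Set.mem_ofPred_eq, not_or, not_not] at h
    apply hi
    rw [Equiv.Perm.mul_apply, h.2, h.1]
  inv_mem' := by
    intro a ha
    refine Set.Finite.subset ha ?_
    intro i hi h
    apply hi
    rw [Equiv.Perm.inv_eq_iff_eq]
    exact h.symm

namespace SInf

/-- The permutation `w × v`: `w` acts on `0, …, p - 1`, and `v`, shifted by `p`, on the rest. -/
def directSum {p : ℕ} (w : Equiv.Perm (Fin p)) (v : SInf) : SInf :=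
  ⟨(finSumNatEquiv p).permCongr (Equiv.sumCongr w v.1), by
    have hv : {i | v.1 i ≠ i}.Finite := v.2
    refine ((Set.finite_lt_nat p).union (hv.image (fun i => p + i))).subset ?_
    intro i hi
    by_cases h : i < p
    · exact Or.inl h
    · right
      have h' : p ≤ i := Nat.le_of_not_lt h
      refine ⟨i - p, ?_, Nat.add_sub_cancel' h'⟩
      intro hfix
      apply hi
      rw [Equiv.permCongr_apply, finSumNatEquiv_symm_apply_of_ge h', Equiv.sumCongr_apply,
        Sum.map_inr, hfix, finSumNatEquiv_apply_right, Nat.add_sub_cancel' h']⟩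

/-- The inclusion of `S_p` in `S_∞`. -/
def ofFin {p : ℕ} (w : Equiv.Perm (Fin p)) : SInf := directSum w 1

/-- The permutation `1ⁿ × v`. -/
def ones (n : ℕ) (v : SInf) : SInf := directSum (1 : Equiv.Perm (Fin n)) v

/-- The transposition of `i` and `j`. -/
def transp (i j : ℕ) : SInf :=
  ⟨Equiv.swap i j, by
    refine (Set.toFinite ({i, j} : Set ℕ)).subset ?_
    intro k hk
    by_contra h
    simp only [Set.mem_insert_iff, Set.mem_singleton_iff, not_or] at h
    exact hk (Equiv.swap_apply_of_ne_of_ne h.1 h.2)⟩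

/-- The entry `c_i` of the code of `w`. -/
noncomputable def code (w : SInf) (i : ℕ) : ℕ := {j | i < j ∧ w.1 j < w.1 i}.ncard

/-- The length `ℓ(c(w))` of the code: the last (one-based) position of a nonzero entry, and `0`
if there is none. -/
noncomputable def codeLength (w : SInf) : ℕ := sSup {k | ∃ i, k = i + 1 ∧ code w i ≠ 0}

/-- The length `ℓ(w)`: the number of inversions. -/
noncomputable def length (w : SInf) : ℕ :=
  {x : ℕ × ℕ | x.1 < x.2 ∧ w.1 x.2 < w.1 x.1}.ncard

/-- The descents of `w`. -/
def descents (w : SInf) : Set ℕ := {i | w.1 (i + 1) < w.1 i}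

/-- A permutation is Grassmannian if it has at most one descent. -/
def IsGrassmannian (w : SInf) : Prop := (descents w).Subsingleton

/-- The diagram `D(w)`: the box in row `i` and column `w k` for every inversion `i < k`,
`w k < w i`. -/
def diagram (w : SInf) : Set (ℕ × ℕ) :=
  {b | ∃ k, b.1 < k ∧ w.1 k < w.1 b.1 ∧ b.2 = w.1 k}

/-! ### Schubert polynomials and Stanley symmetric functions -/

/-- `a` is a reduced word of `w`; the letter `k` stands for the transposition of `k`, `k + 1`. -/
def IsReducedWord (w : SInf) (a : List ℕ) : Prop :=
  (a.map fun k => transp k (k + 1)).prod = w ∧ a.length = length w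

/-- Lists `(a_1, i_1), …, (a_p, i_p)` such that `a` is a reduced word of `w` and `i` is an
`a`-compatible sequence.  For each `w` there are finitely many of them. -/
def compatibleWords (w : SInf) : Set (List (ℕ × ℕ)) :=
  {l | IsReducedWord w (l.map Prod.fst) ∧
    l.IsChain (fun x y => x.2 ≤ y.2) ∧
    (∀ x ∈ l, x.2 ≤ x.1) ∧
    l.IsChain (fun x y => x.1 < y.1 → x.2 < y.2)}

/-- The Schubert polynomial of `w`, the sum of `x_{i_1} ⋯ x_{i_p}` over all reduced words of `w`
and all sequences compatible with them. -/
noncomputable def schubert (w : SInf) : MvPolynomial ℕ ℤ :=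
  ∑ᶠ l ∈ compatibleWords w, (l.map fun x => MvPolynomial.X x.2).prod

/-- The Stanley symmetric function of `w`, the coefficientwise limit of the Schubert polynomials
of `1ⁿ × w`. -/
noncomputable def stanley (w : SInf) : MvPowerSeries ℕ ℤ := fun d =>
  Filter.limUnder Filter.atTop fun n : ℕ => MvPolynomial.coeff d (schubert (ones n w))

/-- `c` is the family of coefficients of an expansion of `f` into Schubert polynomials. -/
def IsSchubertExpansion (f : MvPolynomial ℕ ℤ) (c : SInf →₀ ℤ) : Prop :=
  f = c.sum fun v a => a • schubert v

/-- The coefficients of the expansion of `f` into Schubert polynomials (the Schubert polynomials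
are a `ℤ`-basis, so that the expansion exists and is unique). -/
noncomputable def schubertExpansion (f : MvPolynomial ℕ ℤ) : SInf →₀ ℤ :=
  Classical.epsilon (IsSchubertExpansion f)

/-- The coefficients of the expansion of the product of the Schubert polynomials of `1ⁱ × w` and
`1ⁱ × u` into Schubert polynomials. -/
noncomputable def prodCoeff (w u : SInf) (i : ℕ) : SInf →₀ ℤ :=
  schubertExpansion (schubert (ones i w) * schubert (ones i u))

open Classical in
/-- The set `V_i` of the permutations that are new in the expansion for `1ⁱ × w`, `1ⁱ × u`,
compared to the one for `i - 1`: those not of the form `1 × v` with `v` in the latter. -/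
noncomputable def newTerms (w u : SInf) : ℕ → Finset SInf
  | 0 => (prodCoeff w u 0).support
  | i + 1 => (prodCoeff w u (i + 1)).support.filter
      fun v => ∀ v' ∈ (prodCoeff w u i).support, v ≠ ones 1 v'

/-- The index set `V = V_0 ∪ ⋯ ∪ V_k`, `k = ℓ(w) + ℓ(u)`, of the canonical expansion of
`F_w F_u`; every `v ∈ V_i` is recorded together with `i`.  The term of `⟨i, v⟩` in the canonical
expansion is `prodCoeff w u i v • stanley v`. -/
noncomputable def canonicalTerms (w u : SInf) : Finset (Σ _ : ℕ, SInf) :=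
  (Finset.range (length w + length u + 1)).sigma (newTerms w u)

/-! ### Maximal transitions -/

/-- An MT-move from `x` to `y`: with `r` the largest descent of `x` and `s` the largest position
with `x s < x r`, `y = x t_{rs} t_{jr}` for some `j < r`, and `y` has the same length as `x`. -/
def IsMTMove (x y : SInf) : Prop :=
  ∃ r s j, IsGreatest (descents x) r ∧ IsGreatest {s | x.1 s < x.1 r} s ∧ j < r ∧
    y = x * transp r s * transp j r ∧ length y = length x

/-- All boxes of the diagram of `x` lie in the first `N` rows. -/
def BoxesInFirstRows (N : ℕ) (x : SInf) : Prop := ∀ b ∈ diagram x, b.1 < N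

/-- `l` is a complete run, from `x` to `y`, of successive MT-moves: no move is applied to a
permutation whose diagram lies in the first `N` rows, and the run ends only there or where no
move is possible. -/
structure IsMTRun (N : ℕ) (x y : SInf) (l : List SInf) : Prop where
  head : l.head? = some x
  last : l.getLast? = some y
  chain : l.IsChain fun a b => ¬ BoxesInFirstRows N a ∧ IsMTMove a b
  final : BoxesInFirstRows N y ∨ ∀ z, ¬ IsMTMove y z

/-- The complete runs from `x` that end with the diagram `D`.  The multiset of the diagrams
obtained from `D(x)` contains `D` once for each of them. -/
def mtRunsTo (N : ℕ) (x : SInf) (D : Set (ℕ × ℕ)) : Set (List SInf) :=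
  {l | ∃ y, IsMTRun N x y l ∧ diagram y = D}

end SInf

namespace SInf

/-! Put `N = n + m` and set the variables `x_N, x_{N+1}, …` to zero in the Schubert polynomial of
`1ⁿ × w × u`. This polynomial is the product of those of `1ⁿ × w` and `1^{n+p} × u`. The first
factor only involves variables below `N`. As the only descent of `u`, if any, is its `m`-th
position, the second factor truncates to the Schubert polynomial of `1ⁿ × u`
(`trunc_schubert_ones_directSum`). So the truncation is the product that has to be expanded.

Transitions compute the same truncation. Monk's formula gives `𝔖_x = x_r 𝔖_{x t_{rs}} + ∑ 𝔖_y`, the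
sum being over the MT-moves `x → y` (`IsMaxTransition.schubert_eq`). While `r ≥ N` the first term
truncates to zero, and once all boxes are in the first `N` rows truncation changes nothing. Hence
the product is the sum of `𝔖_y` over the ends `y` of all runs (`exists_runsExpand`), and by linear
independence its coefficients count runs. No run gets stuck, because moves preserve the property
that there are at least as many initial fixed points as nonempty rows from `N` on (`HasRoom`).

Let `ρ ≤ m` be the number of nonempty rows of `D(u)`. The argument applies for `n ≥ ρ`, and the
surplus `n - ρ` survives as initial fixed points of the ends. So for `n > ρ` every term is some `1 ×
v'`, and `V_n` is empty. Setting `x_0 = 0` and shifting carries the expansion for `n + 1` to that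
for `n`; thus `c_i(v) = c_m(1^{m-i} × v)`, and the expansion of `F_w F_u` is read off at a large
level.

The divided difference recursion comes from the Fomin–Stanley commutation relations. Most further
identities follow by induction on length, since a polynomial invariant under all adjacent swaps and
without constant term is zero (`eq_zero_of_symmetric`). -/

@[simp] theorem mul_apply (x y : SInf) (i : ℕ) : (x * y).1 i = x.1 (y.1 i) := rfl

@[simp] theorem one_apply (i : ℕ) : (1 : SInf).1 i = i := rfl

theorem transp_apply (i j k : ℕ) : (transp i j).1 k = if k = i then j else if k = j then i else k :=
  Equiv.swap_apply_def i j k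

@[ext] theorem ext {x y : SInf} (h : ∀ i, x.1 i = y.1 i) : x = y :=
  Subtype.ext (Equiv.ext h)

@[simp] theorem transp_mul_self (i j : ℕ) : transp i j * transp i j = 1 :=
  Subtype.ext (Equiv.swap_mul_self i j)

@[simp] theorem mul_transp_cancel (x : SInf) (i j : ℕ) : x * transp i j * transp i j = x := by
  rw [mul_assoc, transp_mul_self, mul_one]

theorem apply_inj (x : SInf) {i j : ℕ} : x.1 i = x.1 j ↔ i = j := x.1.injective.eq_iff

theorem exists_fixed (x : SInf) : ∃ n, ∀ i, n ≤ i → x.1 i = i := by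
  obtain ⟨n, hn⟩ := (x.2 : {i | x.1 i ≠ i}.Finite).bddAbove
  refine ⟨n + 1, fun i hi => ?_⟩
  by_contra h
  have := hn h
  omega

theorem apply_lt {x : SInf} {n : ℕ} (h : ∀ i, n ≤ i → x.1 i = i) {i : ℕ} (hi : i < n) :
    x.1 i < n := by
  by_contra hc
  have h1 := h _ (not_lt.1 hc)
  rw [apply_inj] at h1
  omega

theorem inversion_lt {x : SInf} {n : ℕ} (h : ∀ i, n ≤ i → x.1 i = i) {i k : ℕ} (hik : i < k)
    (hx : x.1 k < x.1 i) : k < n := by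
  by_contra hc
  have h1 := h k (not_lt.1 hc)
  by_cases hi : i < n
  · have := apply_lt h hi
    omega
  · have := h i (not_lt.1 hi)
    omega

/-! ### Inversions, length and descents. -/

/-- The set of inversions. -/
def inversions (w : SInf) : Set (ℕ × ℕ) := {x | x.1 < x.2 ∧ w.1 x.2 < w.1 x.1}

theorem length_eq (w : SInf) : length w = (inversions w).ncard := rfl

theorem finite_inversions (w : SInf) : (inversions w).Finite := by
  obtain ⟨n, hn⟩ := exists_fixed w
  refine ((Set.finite_lt_nat n).prod (Set.finite_lt_nat n)).subset ?_
  rintro ⟨i, k⟩ ⟨h1, h2⟩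
  have := inversion_lt hn h1 h2
  exact ⟨lt_trans h1 this, this⟩

/-- Exchanging the positions `i` and `i + 1` carries the inversions of `w` bijectively to those of
the product, except for the new inversion `(i, i + 1)`. -/
theorem length_mul_adj {w : SInf} {i : ℕ} (h : w.1 i < w.1 (i + 1)) :
    length (w * transp i (i + 1)) = length w + 1 := by
  have hinj : Function.Injective (Prod.map (Equiv.swap i (i + 1)) (Equiv.swap i (i + 1))) :=
    (Equiv.injective _).prodMap (Equiv.injective _)
  have hset : inversions (w * transp i (i + 1)) =
      insert (i, i + 1) ((Prod.map (Equiv.swap i (i + 1)) (Equiv.swap i (i + 1))) '' inversions w) := by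
    ext ⟨a, b⟩
    simp only [inversions, Set.mem_insert_iff, Set.mem_image, Set.mem_ofPred_eq, mul_apply,
      Prod.exists, Prod.map_apply, Prod.mk.injEq, transp]
    constructor
    · rintro ⟨h1, h2⟩
      by_cases hab : a = i ∧ b = i + 1
      · exact Or.inl hab
      · refine Or.inr ⟨_, _, ⟨?_, h2⟩, Equiv.swap_apply_self _ _ _, Equiv.swap_apply_self _ _ _⟩
        simp only [Equiv.swap_apply_def]
        split_ifs <;> omega
    · rintro (⟨rfl, rfl⟩ | ⟨c, d, ⟨h1, h2⟩, rfl, rfl⟩)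
      · simpa using h
      · simp only [Equiv.swap_apply_self]
        refine ⟨?_, h2⟩
        have : ¬ (c = i ∧ d = i + 1) := by
          rintro ⟨rfl, rfl⟩
          omega
        simp only [Equiv.swap_apply_def]
        split_ifs <;> omega
  rw [length_eq, hset, Set.ncard_insert_of_notMem _ ((finite_inversions w).image _),
    Set.ncard_image_of_injective _ hinj, length_eq]
  rintro ⟨⟨c, d⟩, ⟨h1, h2⟩, h3⟩
  simp only [Prod.map_apply, Prod.mk.injEq] at h3
  obtain ⟨h3, h4⟩ := h3
  rw [Equiv.swap_apply_eq_iff] at h3 h4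
  simp only [Equiv.swap_apply_left, Equiv.swap_apply_right] at h3 h4
  subst h3 h4
  exact absurd h1 (by simp)

theorem lt_or_desc (w : SInf) (i : ℕ) : w.1 i < w.1 (i + 1) ∨ w.1 (i + 1) < w.1 i := by
  have : w.1 i ≠ w.1 (i + 1) := by rw [Ne, apply_inj]; omega
  omega

theorem length_mul_adj_of_desc {w : SInf} {i : ℕ} (h : w.1 (i + 1) < w.1 i) :
    length (w * transp i (i + 1)) + 1 = length w := by
  have := length_mul_adj (w := w * transp i (i + 1)) (i := i) (by simpa [transp] using h)
  rw [mul_transp_cancel] at this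
  exact this.symm

theorem length_one : length 1 = 0 := by
  rw [length_eq, Set.ncard_eq_zero (finite_inversions _)]
  ext ⟨a, b⟩
  simp only [Set.mem_empty_iff_false, iff_false]
  exact fun h => lt_asymm h.1 h.2

theorem lt_of_no_desc {x : SInf} {n : ℕ} (h : ∀ i, n ≤ i → x.1 i < x.1 (i + 1)) {i k : ℕ}
    (hi : n ≤ i) (hik : i < k) : x.1 i < x.1 k := by
  induction k, hik using Nat.le_induction with
  | base => exact h i hi
  | succ k hk ih => exact ih.trans (h k (by omega))

theorem fixed_of_no_desc {x : SInf} (h : ∀ i, x.1 i < x.1 (i + 1)) : x = 1 := by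
  have hmono : StrictMono x.1 := strictMono_nat_of_lt_succ h
  ext i
  obtain ⟨n, hn⟩ := exists_fixed x
  have h1 : i ≤ x.1 i := hmono.id_le i
  -- The excess of `x i` over `i` never shrinks to the right, and it is zero at the fixed point `i +
  -- n`.
  have h2 : ∀ k, x.1 i + k ≤ x.1 (i + k) := by
    intro k
    induction k with
    | zero => simp
    | succ k ih => have := h (i + k); rw [← add_assoc, ← add_assoc]; omega
  have h3 := h2 n
  rw [hn (i + n) (by omega)] at h3
  simp only [one_apply]
  omega

theorem exists_desc {x : SInf} (h : x ≠ 1) : ∃ i, x.1 (i + 1) < x.1 i := by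
  by_contra! hc
  exact h (fixed_of_no_desc fun i => (lt_or_desc x i).resolve_right (not_lt.2 (hc i)))

theorem length_eq_zero {x : SInf} : length x = 0 ↔ x = 1 := by
  constructor
  · intro h
    by_contra hx
    obtain ⟨i, hi⟩ := exists_desc hx
    have := length_mul_adj_of_desc hi
    omega
  · rintro rfl
    exact length_one

/-! ### Covers in the Bruhat order. -/

/-- `x` is covered by `x t_{ab}` in the Bruhat order. -/
def Cov (x : SInf) (a b : ℕ) : Prop :=
  a < b ∧ x.1 a < x.1 b ∧ ∀ c, a < c → c < b → x.1 c < x.1 a ∨ x.1 b < x.1 c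

/-- Conjugation by the adjacent transposition of `i`, `i + 1` brings `b = i + 1` down to `i`. The
two outer factors both raise the length if `x i` lies between `x a` and `x b`; otherwise their
effects cancel. -/
theorem length_mul_transp (x : SInf) {a b : ℕ} (hab : a < b) (h : x.1 a < x.1 b) :
    length (x * transp a b) = length x + 1 +
      2 * ((Finset.Ioo a b).filter fun c => x.1 a < x.1 c ∧ x.1 c < x.1 b).card := by
  induction b, hab using Nat.le_induction generalizing x with
  | base =>
    rw [length_mul_adj h]
    have : Finset.Ioo a a.succ = ∅ := by ext; simp; try omega
    simp
  | succ i hi ih =>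
    have hconj : x * transp a (i + 1) =
        x * transp i (i + 1) * transp a i * transp i (i + 1) := by
      ext c
      simp only [mul_apply, transp_apply]
      congr 1
      split_ifs <;> omega
    have hI : Finset.Ioo a (i + 1) = insert i (Finset.Ioo a i) := by ext; simp; omega
    have e1 : (x * transp i (i + 1)).1 a = x.1 a := by
      simp only [mul_apply, transp_apply]; congr 1; split_ifs <;> omega
    have e2 : (x * transp i (i + 1)).1 i = x.1 (i + 1) := by simp [transp_apply]
    have e3 : ∀ c ∈ Finset.Ioo a i, (x * transp i (i + 1)).1 c = x.1 c := by
      intro c hc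
      simp only [Finset.mem_Ioo] at hc
      simp only [mul_apply, transp_apply]; congr 1; split_ifs <;> omega
    have e4 : (x * transp i (i + 1) * transp a i).1 i = x.1 a := by
      simp only [mul_apply, transp_apply]; congr 1; split_ifs <;> omega
    have e5 : (x * transp i (i + 1) * transp a i).1 (i + 1) = x.1 i := by
      simp only [mul_apply, transp_apply]; congr 1; split_ifs <;> omega
    have key := ih (x * transp i (i + 1)) (by rw [e1, e2]; exact h)
    rw [e1, e2, Finset.filter_congr (q := fun c => x.1 a < x.1 c ∧ x.1 c < x.1 (i + 1))
      (fun c hc => by rw [e3 c hc])] at key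
    have hne : x.1 a ≠ x.1 i := by rw [Ne, apply_inj]; omega
    rw [hconj, hI, Finset.filter_insert]
    have hnot : i ∉ (Finset.Ioo a i).filter (fun c => x.1 a < x.1 c ∧ x.1 c < x.1 (i + 1)) := by
      simp
    rcases lt_or_desc x i with h1 | h1
    · have l1 := length_mul_adj h1
      rcases lt_or_gt_of_ne hne with h2 | h2
      · have l2 := length_mul_adj (w := x * transp i (i + 1) * transp a i) (i := i)
          (by rw [e4, e5]; exact h2)
        rw [if_pos ⟨h2, h1⟩, Finset.card_insert_of_notMem hnot]
        omega
      · have l2 := length_mul_adj_of_desc (w := x * transp i (i + 1) * transp a i) (i := i)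
          (by rw [e4, e5]; exact h2)
        rw [if_neg (by omega)]
        omega
    · have l1 := length_mul_adj_of_desc h1
      have l2 := length_mul_adj (w := x * transp i (i + 1) * transp a i) (i := i)
          (by rw [e4, e5]; omega)
      rw [if_neg (by omega)]
      omega

theorem Cov.length_eq {x : SInf} {a b : ℕ} (h : Cov x a b) :
    length (x * transp a b) = length x + 1 := by
  rw [length_mul_transp x h.1 h.2.1, Finset.filter_false_of_mem]
  · simp
  · intro c hc
    have := h.2.2 c (Finset.mem_Ioo.1 hc).1 (Finset.mem_Ioo.1 hc).2
    omega

theorem cov_of_length_eq {x : SInf} {a b : ℕ} (hab : a < b)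
    (h : length (x * transp a b) = length x + 1) : Cov x a b := by
  have hne : x.1 a ≠ x.1 b := by rw [Ne, apply_inj]; omega
  rcases lt_or_gt_of_ne hne with h1 | h1
  · rw [length_mul_transp x hab h1] at h
    have h0 : ((Finset.Ioo a b).filter fun c => x.1 a < x.1 c ∧ x.1 c < x.1 b).card = 0 := by
      omega
    rw [Finset.card_eq_zero, Finset.filter_eq_empty_iff] at h0
    refine ⟨hab, h1, fun c h2 h3 => ?_⟩
    have h4 := h0 (Finset.mem_Ioo.2 ⟨h2, h3⟩)
    have h5 : x.1 c ≠ x.1 a := by rw [Ne, apply_inj]; omega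
    have h6 : x.1 c ≠ x.1 b := by rw [Ne, apply_inj]; omega
    omega
  · have h2 := length_mul_transp (x * transp a b) hab (by simpa [transp] using h1)
    rw [mul_transp_cancel] at h2
    omega

/-! ### Reduced words. -/

theorem mul_transp_eq_iff {x y : SInf} {i j : ℕ} : x * transp i j = y ↔ x = y * transp i j := by
  constructor
  · rintro rfl
    rw [mul_transp_cancel]
  · rintro rfl
    rw [mul_transp_cancel]

theorem length_mul_adj_le (w : SInf) (i : ℕ) : length (w * transp i (i + 1)) ≤ length w + 1 := by
  rcases lt_or_desc w i with h | h
  · exact (length_mul_adj h).le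
  · have := length_mul_adj_of_desc h
    omega

theorem length_word_le (a : List ℕ) : length (a.map fun k => transp k (k + 1)).prod ≤ a.length := by
  induction a using List.reverseRecOn with
  | nil => simp [length_one]
  | append_singleton a k ih =>
    simp only [List.map_append, List.map_cons, List.map_nil, List.prod_append, List.prod_singleton,
      List.length_append, List.length_singleton]
    exact (length_mul_adj_le _ _).trans (by omega)

theorem isReducedWord_nil (w : SInf) : IsReducedWord w [] ↔ w = 1 := by
  simp only [IsReducedWord, List.map_nil, List.prod_nil, List.length_nil]
  constructor
  · exact fun h => h.1.symm
  · rintro rfl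
    exact ⟨rfl, length_one.symm⟩

/-- A word is never shorter than the length of its product. So the last letter of a reduced word
must have raised the length, which makes it a descent of `w`. -/
theorem isReducedWord_append_singleton (w : SInf) (a : List ℕ) (k : ℕ) :
    IsReducedWord w (a ++ [k]) ↔
      w.1 (k + 1) < w.1 k ∧ IsReducedWord (w * transp k (k + 1)) a := by
  simp only [IsReducedWord, List.map_append, List.map_cons, List.map_nil, List.prod_append,
    List.prod_singleton, List.length_append, List.length_singleton]
  rw [mul_transp_eq_iff]
  have hle := length_word_le a
  constructor
  · rintro ⟨h1, h2⟩
    rw [h1] at hle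
    rcases lt_or_desc w k with h | h
    · have := length_mul_adj h
      omega
    · have := length_mul_adj_of_desc h
      exact ⟨h, h1, by omega⟩
  · rintro ⟨h, h1, h2⟩
    have := length_mul_adj_of_desc h
    exact ⟨h1, by omega⟩

theorem IsReducedWord.letter_lt {w : SInf} {a : List ℕ} (h : IsReducedWord w a) {n : ℕ}
    (hn : ∀ i, n ≤ i → w.1 i = i) : ∀ k ∈ a, k + 1 < n := by
  induction a using List.reverseRecOn generalizing w with
  | nil => simp
  | append_singleton a k ih =>
    rw [isReducedWord_append_singleton] at h
    have hk := inversion_lt hn (Nat.lt_succ_self k) h.1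
    intro l hl
    rw [List.mem_append, List.mem_singleton] at hl
    rcases hl with hl | rfl
    · refine ih h.2 (fun i hi => ?_) l hl
      rw [mul_apply, transp_apply, if_neg (by omega), if_neg (by omega), hn i hi]
    · exact hk

/-! ### The nilCoxeter algebra acting on families of coefficients. -/

section Operators

variable {R : Type*} [CommRing R]

open Classical in
/-- Right multiplication by the generator `u_i` of the nilCoxeter algebra, on coefficients. -/
noncomputable def nilOp (R : Type*) [CommRing R] (i : ℕ) : Module.End R (SInf → R) where
  toFun f w := if w.1 (i + 1) < w.1 i then f (w * transp i (i + 1)) else 0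
  map_add' f g := by
    ext w
    simp only [Pi.add_apply]
    split_ifs <;> simp
  map_smul' c f := by
    ext w
    simp only [Pi.smul_apply, RingHom.id_apply]
    split_ifs <;> simp

open Classical in
theorem nilOp_apply (i : ℕ) (f : SInf → R) (w : SInf) :
    nilOp R i f w = if w.1 (i + 1) < w.1 i then f (w * transp i (i + 1)) else 0 := rfl

theorem nilOp_sq (i : ℕ) : nilOp R i * nilOp R i = 0 := by
  ext f w
  have h : ¬ i + 1 = i := by omega
  simp only [Module.End.mul_apply, nilOp_apply, mul_apply, transp_apply, LinearMap.zero_apply,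
    Pi.zero_apply, h, if_true, if_false]
  split_ifs <;> first | rfl | omega

theorem nilOp_comm {i j : ℕ} (h : i + 1 < j) : nilOp R i * nilOp R j = nilOp R j * nilOp R i := by
  ext f w
  simp only [Module.End.mul_apply, nilOp_apply, mul_apply, transp_apply]
  have e : w * transp i (i + 1) * transp j (j + 1) = w * transp j (j + 1) * transp i (i + 1) := by
    ext c
    simp only [mul_apply, transp_apply]
    congr 1
    split_ifs <;> omega
  rw [e]
  rw [if_neg (show ¬ j + 1 = i by omega), if_neg (show ¬ j + 1 = i + 1 by omega),
    if_neg (show ¬ j = i by omega), if_neg (show ¬ j = i + 1 by omega),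
    if_neg (show ¬ i + 1 = j by omega), if_neg (show ¬ i + 1 = j + 1 by omega),
    if_neg (show ¬ i = j by omega), if_neg (show ¬ i = j + 1 by omega)]
  split_ifs <;> rfl

theorem nilOp_braid (i : ℕ) : nilOp R i * nilOp R (i + 1) * nilOp R i =
    nilOp R (i + 1) * nilOp R i * nilOp R (i + 1) := by
  ext f w
  simp only [Module.End.mul_apply, nilOp_apply, mul_apply, transp_apply]
  have e : w * transp i (i + 1) * transp (i + 1) (i + 1 + 1) * transp i (i + 1) =
      w * transp (i + 1) (i + 1 + 1) * transp i (i + 1) * transp (i + 1) (i + 1 + 1) := by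
    ext c
    simp only [mul_apply, transp_apply]
    congr 1
    split_ifs <;> omega
  rw [e]
  have h1 : ¬ i + 1 = i := by omega
  have h2 : ¬ i + 1 + 1 = i := by omega
  have h3 : ¬ i + 1 + 1 = i + 1 := by omega
  have h4 : ¬ i = i + 1 := by omega
  have h5 : ¬ i = i + 1 + 1 := by omega
  have h6 : ¬ i + 1 = i + 1 + 1 := by omega
  simp only [h1, h2, h3, h4, h5, h6, if_true, if_false]
  split_ifs <;> rfl

/-- The composition of the operators for the letters of a word, the first letter innermost. -/
noncomputable def wordOp (R : Type*) [CommRing R] : List ℕ → Module.End R (SInf → R)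
  | [] => 1
  | k :: a => wordOp R a * nilOp R k

theorem wordOp_append (a b : List ℕ) : wordOp R (a ++ b) = wordOp R b * wordOp R a := by
  induction a with
  | nil => simp [wordOp]
  | cons k a ih => simp [wordOp, ih, mul_assoc]

open Classical in
/-- The coefficients of the unit of the nilCoxeter algebra. -/
noncomputable def unitCoeff (R : Type*) [CommRing R] : SInf → R := fun w => if w = 1 then 1 else 0

open Classical in
-- The coefficient of `w` in a monomial of the nilCoxeter algebra detects reduced words: peeling off
-- the last letter gives the recursion of `isReducedWord_append_singleton`.
theorem wordOp_apply (a : List ℕ) (w : SInf) :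
    wordOp R a (unitCoeff R) w = if IsReducedWord w a then 1 else 0 := by
  induction a using List.reverseRecOn generalizing w with
  | nil => simp [wordOp, isReducedWord_nil, unitCoeff]
  | append_singleton a k ih =>
    rw [wordOp_append, Module.End.mul_apply]
    simp only [wordOp, one_mul, nilOp_apply, ih, isReducedWord_append_singleton]
    split_ifs <;> simp_all

theorem isChain_ne_of_wordOp {a : List ℕ} (h : wordOp R a ≠ 0) : a.IsChain (· ≠ ·) := by
  induction a with
  | nil => exact List.IsChain.nil
  | cons k a ih =>
    have h1 : wordOp R a ≠ 0 := by
      intro h0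
      apply h
      rw [wordOp, h0, zero_mul]
    cases a with
    | nil => exact List.IsChain.singleton _
    | cons l a =>
      refine List.IsChain.cons_cons ?_ (ih h1)
      rintro rfl
      apply h
      rw [wordOp, wordOp, mul_assoc, nilOp_sq, mul_zero]

theorem IsReducedWord.isChain_ne {w : SInf} {a : List ℕ} (h : IsReducedWord w a) :
    a.IsChain (· ≠ ·) := by
  refine isChain_ne_of_wordOp (R := ℤ) fun h0 => ?_
  have := wordOp_apply (R := ℤ) a w
  rw [h0, if_pos h] at this
  exact zero_ne_one this

end Operators

/-! ### The commutation relations of Fomin and Stanley -/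

section FominStanley

variable {R E : Type*} [CommRing R] [Ring E] [Algebra R E] (u : ℕ → E)

/-- The product `(1 + t u_i) ⋯ (1 + t u_{n-1})`, where `k = n - i`. -/
def rowProd (n : ℕ) (t : R) : ℕ → E
  | 0 => 1
  | k + 1 => (1 + t • u (n - (k + 1))) * rowProd n t k

/-- The relations of the nilCoxeter algebra. -/
structure NilCoxeter : Prop where
  sq : ∀ i, u i * u i = 0
  comm : ∀ i j, i + 1 < j → u i * u j = u j * u i
  braid : ∀ i, u i * u (i + 1) * u i = u (i + 1) * u i * u (i + 1)

variable {u}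

theorem NilCoxeter.mul_sub_cancel (hu : NilCoxeter u) (t : R) (i : ℕ) :
    (1 - t • u i) * (1 + t • u i) = 1 := by
  simp only [sub_mul, mul_add, one_mul, mul_one, smul_mul_smul_comm, hu.sq, smul_zero]
  abel

theorem NilCoxeter.rowProd_comm_letter (hu : NilCoxeter u) (n : ℕ) (t : R) (k i : ℕ)
    (h : i + 1 + k < n) : u i * rowProd u n t k = rowProd u n t k * u i := by
  induction k with
  | zero => simp [rowProd]
  | succ k ih =>
    rw [rowProd, ← mul_assoc, mul_add, mul_one, mul_smul_comm, hu.comm i _ (by omega),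
      ← smul_mul_assoc, ← one_add_mul, mul_assoc, ih (by omega), mul_assoc]

/-- By nilpotency and the braid relation, each side expands to `1 + (x + y) a + x y (b a - a b)`
with `a = u i`, `b = u (i + 1)`, which is symmetric in `x` and `y`. -/
theorem NilCoxeter.four_factor (hu : NilCoxeter u) (x y : R) (i : ℕ) :
    (1 + y • u i) * (1 + y • u (i + 1)) * (1 + x • u i) * (1 - y • u (i + 1)) =
    (1 + x • u i) * (1 + x • u (i + 1)) * (1 + y • u i) * (1 - x • u (i + 1)) := by
  have ha := hu.sq i
  have hb := hu.sq (i + 1)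
  have hab := hu.braid i
  generalize u i = a at *
  generalize u (i + 1) = b at *
  have key : ∀ x y : R, (1 + y • a) * (1 + y • b) * (1 + x • a) * (1 - y • b) =
      1 + (x + y) • a + (x * y) • (b * a - a * b) := by
    intro x y
    have h1 : a * b * a * b = 0 := by rw [mul_assoc (a * b), ← mul_assoc, hab]; simp [mul_assoc, hb]
    have h2 : (1 + y • b) * (1 + x • a) * (1 - y • b) =
        1 + x • a + (x * y) • (b * a - a * b) - (x * y * y) • (b * a * b) := by
      simp only [mul_add, add_mul, mul_sub, one_mul, mul_one,
        smul_mul_assoc, mul_smul_comm, hb, smul_zero, smul_sub]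
      module
    rw [mul_assoc, mul_assoc, ← mul_assoc (1 + y • b), h2]
    have h3 : a * (b * a * b) = 0 := by rw [← mul_assoc, ← mul_assoc, h1]
    have h4 : a * (b * a) = b * a * b := by rw [← mul_assoc, hab]
    have h5 : a * (a * b) = 0 := by rw [← mul_assoc, ha, zero_mul]
    simp only [mul_add, add_mul, mul_sub, one_mul, mul_one,
        smul_mul_assoc, mul_smul_comm, ha, h3, h4, h5, smul_zero, smul_sub, smul_add]
    module
  rw [key, key, add_comm x, mul_comm x]

/-- Induction on the number of letters. Splitting off four factors leaves a product of two shorter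
rows, which commute by induction, and `four_factor` shows that the split part is symmetric as well.
-/
theorem NilCoxeter.rowProd_comm (hu : NilCoxeter u) (n : ℕ) (x y : R) (k : ℕ) (hk : k ≤ n) :
    rowProd u n x k * rowProd u n y k = rowProd u n y k * rowProd u n x k := by
  induction k with
  | zero => simp [rowProd]
  | succ k ih =>
    cases k with
    | zero =>
      simp only [rowProd, mul_one, mul_add, add_mul, one_mul, smul_mul_smul_comm, hu.sq]
      module
    | succ k =>
      have ih := ih (by omega)
      set i := n - (k + 1 + 1) with hi
      have hi1 : n - (k + 1) = i + 1 := by omega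
      -- The letters from `i + 2` on commute with `u i`, and their product is the row from `i + 1`
      -- on, divided by its first factor.
      have expand : ∀ x y : R, rowProd u n x (k + 1 + 1) * rowProd u n y (k + 1 + 1) =
          (1 + x • u i) * (1 + x • u (i + 1)) * (1 + y • u i) * (1 - x • u (i + 1)) *
            (rowProd u n x (k + 1) * rowProd u n y (k + 1)) := by
        intro x y
        have h1 : rowProd u n x k * (1 + y • u i) = (1 + y • u i) * rowProd u n x k := by
          rw [mul_add, add_mul, mul_smul_comm, smul_mul_assoc,
            hu.rowProd_comm_letter n x k i (by omega), one_mul, mul_one]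
        have h2 : rowProd u n x k = (1 - x • u (i + 1)) * rowProd u n x (k + 1) := by
          rw [rowProd, hi1, ← mul_assoc, hu.mul_sub_cancel, one_mul]
        calc rowProd u n x (k + 1 + 1) * rowProd u n y (k + 1 + 1)
            = (1 + x • u i) * (1 + x • u (i + 1)) * (rowProd u n x k * (1 + y • u i)) *
                rowProd u n y (k + 1) := by
              rw [rowProd.eq_2 u n x (k + 1), rowProd.eq_2 u n x k, rowProd.eq_2 u n y (k + 1), hi1,
                ← hi]
              simp only [mul_assoc]
          _ = _ := by
              rw [h1, h2]
              simp only [mul_assoc]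
      rw [expand, expand, ih, hu.four_factor]

/-- The product of the rows `0, …, k - 1`, the last one outermost. -/
def rowsProd (u : ℕ → E) (n : ℕ) (y : ℕ → R) : ℕ → E
  | 0 => 1
  | k + 1 => rowProd u n (y k) (n - k) * rowsProd u n y k

theorem rowsProd_congr (n : ℕ) {y z : ℕ → R} (k : ℕ) (h : ∀ i < k, y i = z i) :
    rowsProd u n y k = rowsProd u n z k := by
  induction k with
  | zero => rfl
  | succ k ih => rw [rowsProd, rowsProd, ih fun i hi => h i (by omega), h k (by omega)]

/-- The divided difference in operator form. Completing row `i + 1` by the letter `i` makes rows `i`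
and `i + 1` a symmetric product `Z`, at the price of the factor `1 - y_{i+1} u_i`. Only this factor
changes under the exchange, and `u_i` absorbs it because `u_i² = 0`. The later rows only have
letters that commute with `u_i`. -/
theorem NilCoxeter.rowsProd_sub (hu : NilCoxeter u) (n : ℕ) (y : ℕ → R) (i k : ℕ) (hk : i + 2 ≤ k)
    (hkn : k ≤ n) :
    rowsProd u n y k - rowsProd u n (fun j => y (Equiv.swap i (i + 1) j)) k =
      (y i - y (i + 1)) • (u i * rowsProd u n y k) := by
  induction k, hk using Nat.le_induction with
  | base =>
    have h0 : rowsProd u n (fun j => y (Equiv.swap i (i + 1) j)) i = rowsProd u n y i := by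
      refine rowsProd_congr n i fun j hj => ?_
      rw [Equiv.swap_apply_of_ne_of_ne] <;> omega
    have hnk : n - i = n - (i + 1) + 1 := by omega
    have hni : n - (n - (i + 1) + 1) = i := by omega
    have expand : ∀ a b : R, rowProd u n b (n - (i + 1)) * (rowProd u n a (n - i)) =
        (1 - b • u i) * (rowProd u n b (n - i) * rowProd u n a (n - i)) := by
      intro a b
      rw [← mul_assoc, hnk, rowProd.eq_2 u n b, hni, ← mul_assoc (1 - b • u i),
        hu.mul_sub_cancel, one_mul]
    simp only [rowsProd, Equiv.swap_apply_left, Equiv.swap_apply_right, h0]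
    rw [← mul_assoc, ← mul_assoc, expand, expand, hu.rowProd_comm n (y i) _ _ (by omega)]
    generalize rowProd u n (y (i + 1)) (n - i) * rowProd u n (y i) (n - i) = Z
    generalize rowsProd u n y i = P
    have h1 : u i * ((1 - y (i + 1) • u i) * Z * P) = u i * (Z * P) := by
      rw [mul_assoc, ← mul_assoc (u i), mul_sub, mul_smul_comm, hu.sq, smul_zero, sub_zero, mul_one]
    rw [h1]
    simp only [sub_mul, one_mul, smul_mul_assoc, mul_assoc]
    module
  | succ k hk ih =>
    have hc := hu.rowProd_comm_letter n (y k) (n - k) i (by omega)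
    rw [rowsProd, rowsProd, Equiv.swap_apply_of_ne_of_ne (by omega) (by omega), ← mul_sub,
      ih (by omega), ← mul_assoc (u i), hc, mul_smul_comm, mul_assoc]

end FominStanley

open MvPolynomial

/-! ### Compatible words as sublists of a staircase. -/

section Words

variable {R : Type*} [CommRing R]

theorem nilCoxeter_nilOp : NilCoxeter (nilOp R) :=
  ⟨nilOp_sq, fun _ _ h => nilOp_comm h, nilOp_braid⟩

/-- The composition of the operators `1 + y_i u_a` for the entries `(a, i)` of a list, the first
entry innermost. -/
noncomputable def listOp (y : ℕ → R) : List (ℕ × ℕ) → Module.End R (SInf → R)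
  | [] => 1
  | b :: L => listOp y L * (1 + y b.2 • nilOp R b.1)

theorem listOp_append (y : ℕ → R) (a b : List (ℕ × ℕ)) :
    listOp y (a ++ b) = listOp y b * listOp y a := by
  induction a with
  | nil => simp [listOp]
  | cons k a ih => simp [listOp, ih, mul_assoc]

theorem listOp_eq_sum (y : ℕ → R) (L : List (ℕ × ℕ)) : listOp y L =
    ((L.sublists').map fun l => (l.map fun x => y x.2).prod • wordOp R (l.map Prod.fst)).sum := by
  induction L with
  | nil => simp [listOp, wordOp]
  | cons b L ih =>
    rw [List.sublists'_cons, List.map_append, List.sum_append, listOp, mul_add, mul_one, ih,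
      List.map_map]
    congr 1
    rw [← List.sum_map_mul_right]
    congr 1
    refine List.map_congr_left fun l _ => ?_
    simp only [Function.comp_apply, List.map_cons, List.prod_cons, wordOp, smul_mul_smul_comm]
    rw [mul_comm]

/-- The pairs `(n - 1, i), …, (n - k, i)`. -/
def rowList (n i : ℕ) : ℕ → List (ℕ × ℕ)
  | 0 => []
  | k + 1 => rowList n i k ++ [(n - (k + 1), i)]

/-- The pairs `(a, i)` with `i ≤ a < n`, for `i = 0, …, k - 1`. -/
def rowsList (n : ℕ) : ℕ → List (ℕ × ℕ)
  | 0 => []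
  | k + 1 => rowsList n k ++ rowList n k (n - k)

theorem listOp_rowList (y : ℕ → R) (n i k : ℕ) :
    listOp y (rowList n i k) = rowProd (nilOp R) n (y i) k := by
  induction k with
  | zero => rfl
  | succ k ih => rw [rowList, listOp_append, ih, rowProd, listOp, listOp, one_mul]

theorem listOp_rowsList (y : ℕ → R) (n k : ℕ) :
    listOp y (rowsList n k) = rowsProd (nilOp R) n y k := by
  induction k with
  | zero => rfl
  | succ k ih => rw [rowsList, listOp_append, ih, rowsProd, listOp_rowList]

/-- The order of the entries of a compatible word. -/
def PairRel (x y : ℕ × ℕ) : Prop := x.2 < y.2 ∨ x.2 = y.2 ∧ y.1 < x.1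

instance : Std.Antisymm PairRel := ⟨fun a b h1 h2 => by
  unfold PairRel at h1 h2
  omega⟩

instance : IsTrans (ℕ × ℕ) PairRel := ⟨fun a b c h1 h2 => by
  unfold PairRel at *
  omega⟩

theorem mem_rowList {n i k : ℕ} (hk : k ≤ n) {x : ℕ × ℕ} :
    x ∈ rowList n i k ↔ x.2 = i ∧ n - k ≤ x.1 ∧ x.1 < n := by
  induction k with
  | zero =>
    simp only [rowList, List.not_mem_nil, false_iff]
    omega
  | succ k ih =>
    rw [rowList, List.mem_append, ih (by omega), List.mem_singleton, Prod.ext_iff]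
    dsimp only
    omega

theorem mem_rowsList {n k : ℕ} (hk : k ≤ n) {x : ℕ × ℕ} :
    x ∈ rowsList n k ↔ x.2 < k ∧ x.2 ≤ x.1 ∧ x.1 < n := by
  induction k with
  | zero => simp [rowsList]
  | succ k ih =>
    rw [rowsList, List.mem_append, ih (by omega), mem_rowList (by omega)]
    omega

theorem pairwise_rowList {n i k : ℕ} (hk : k ≤ n) : (rowList n i k).Pairwise PairRel := by
  induction k with
  | zero => exact List.Pairwise.nil
  | succ k ih =>
    rw [rowList, List.pairwise_append]
    refine ⟨ih (by omega), List.pairwise_singleton _ _, fun a ha b hb => ?_⟩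
    rw [mem_rowList (by omega)] at ha
    rw [List.mem_singleton] at hb
    subst hb
    unfold PairRel
    dsimp only
    omega

theorem pairwise_rowsList {n k : ℕ} (hk : k ≤ n) : (rowsList n k).Pairwise PairRel := by
  induction k with
  | zero => exact List.Pairwise.nil
  | succ k ih =>
    rw [rowsList, List.pairwise_append]
    refine ⟨ih (by omega), pairwise_rowList (by omega), fun a ha b hb => ?_⟩
    rw [mem_rowsList (by omega)] at ha
    rw [mem_rowList (by omega)] at hb
    unfold PairRel
    omega

theorem nodup_rowsList (n : ℕ) : (rowsList n n).Nodup :=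
  (pairwise_rowsList le_rfl).imp fun h => by
    rintro rfl
    unfold PairRel at h
    omega

theorem sublist_rowsList {n : ℕ} {l : List (ℕ × ℕ)} :
    l.Sublist (rowsList n n) ↔ l.Pairwise PairRel ∧ ∀ x ∈ l, x.2 ≤ x.1 ∧ x.1 < n := by
  constructor
  · intro h
    refine ⟨(pairwise_rowsList le_rfl).sublist h, fun x hx => ?_⟩
    exact ((mem_rowsList le_rfl).1 (h.subset hx)).2
  · rintro ⟨h1, h2⟩
    refine List.sublist_of_subperm_of_pairwise (r := PairRel) ?_ h1 (pairwise_rowsList le_rfl)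
    refine List.subperm_of_subset (h1.imp fun h => ?_) fun x hx => ?_
    · rintro rfl
      unfold PairRel at h
      omega
    · have := h2 x hx
      exact (mem_rowsList le_rfl).2 (by omega)

theorem isChain_and {α : Type*} {r s t : α → α → Prop} (h : ∀ a b, r a b → s a b → t a b)
    {l : List α} (h1 : l.IsChain r) (h2 : l.IsChain s) : l.IsChain t := by
  induction h1 with
  | nil => exact List.IsChain.nil
  | singleton a => exact List.IsChain.singleton a
  | cons_cons hr _ ih =>
    rw [List.isChain_cons_cons] at h2
    exact List.IsChain.cons_cons (h _ _ hr h2.1) (ih h2.2)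

/-- Equal neighbouring letters cannot occur in a reduced word, so the letters sharing an index
strictly decrease. This is the order in which `rowsList` runs through the staircase. -/
theorem mem_compatibleWords {w : SInf} {n : ℕ} (hn : ∀ i, n ≤ i → w.1 i = i)
    {l : List (ℕ × ℕ)} : l ∈ compatibleWords w ↔
      l.Sublist (rowsList n n) ∧ IsReducedWord w (l.map Prod.fst) := by
  rw [sublist_rowsList]
  constructor
  · rintro ⟨h1, h2, h3, h4⟩
    refine ⟨⟨?_, fun x hx => ⟨h3 x hx, ?_⟩⟩, h1⟩
    · rw [← List.isChain_iff_pairwise]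
      have h5 := (List.isChain_map _).1 h1.isChain_ne
      refine isChain_and (fun a b h6 h7 => ?_) (isChain_and (fun a b h6 h7 => ?_) h2 h4) h5
        (s := fun a b => a.1 ≠ b.1) (r := fun a b => a.2 ≤ b.2 ∧ (a.1 < b.1 → a.2 < b.2))
      · unfold PairRel
        omega
      · exact ⟨h6, h7⟩
    · have := h1.letter_lt hn x.1 (List.mem_map_of_mem hx)
      omega
  · rintro ⟨⟨h1, h2⟩, h3⟩
    rw [← List.isChain_iff_pairwise] at h1
    refine ⟨h3, h1.imp fun a b h => ?_, fun x hx => (h2 x hx).1, h1.imp fun a b h => ?_⟩ <;>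
    · unfold PairRel at h
      omega

open Classical in
theorem rowsProd_apply (y : ℕ → R) (n : ℕ) (w : SInf) :
    rowsProd (nilOp R) n y n (unitCoeff R) w =
      ∑ l ∈ (rowsList n n).sublists'.toFinset with IsReducedWord w (l.map Prod.fst),
        (l.map fun x => y x.2).prod := by
  rw [← listOp_rowsList, listOp_eq_sum,
    ← List.sum_toFinset _ (List.nodup_sublists'.2 (nodup_rowsList n)), LinearMap.sum_apply,
    Finset.sum_apply, Finset.sum_filter]
  refine Finset.sum_congr rfl fun l _ => ?_
  rw [LinearMap.smul_apply, Pi.smul_apply, wordOp_apply, smul_eq_mul, mul_ite, mul_one, mul_zero]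

/-- Lets renamings of the variables and evaluation at zero act on the parameters of the rows. -/
theorem map_rowsProd_apply {S : Type*} [CommRing S] (g : R →+* S) (y : ℕ → R) (n : ℕ) (w : SInf) :
    g (rowsProd (nilOp R) n y n (unitCoeff R) w) =
      rowsProd (nilOp S) n (fun i => g (y i)) n (unitCoeff S) w := by
  classical
  rw [rowsProd_apply, rowsProd_apply, map_sum]
  refine Finset.sum_congr rfl fun l _ => ?_
  rw [map_list_prod, List.map_map]
  rfl

end Words

/-! ### Schubert polynomials as nilCoxeter coefficients, and divided differences. -/

theorem schubert_eq_rowsProd {w : SInf} {n : ℕ} (hn : ∀ i, n ≤ i → w.1 i = i) :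
    schubert w = rowsProd (nilOp (MvPolynomial ℕ ℤ)) n (X : ℕ → MvPolynomial ℕ ℤ) n (unitCoeff _) w := by
  classical
  rw [rowsProd_apply, schubert]
  have hset : compatibleWords w = ↑((rowsList n n).sublists'.toFinset.filter
      fun l => IsReducedWord w (l.map Prod.fst)) := by
    ext l
    simp [mem_compatibleWords hn]
  rw [hset, finsum_mem_coe_finset]

theorem exists_fixed_ge (w : SInf) (m : ℕ) : ∃ n, m ≤ n ∧ ∀ i, n ≤ i → w.1 i = i := by
  obtain ⟨n, hn⟩ := exists_fixed w
  exact ⟨max m n, le_max_left _ _, fun i hi => hn i (le_trans (le_max_right _ _) hi)⟩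

theorem mul_transp_fixed {w : SInf} {n a b : ℕ} (hn : ∀ i, n ≤ i → w.1 i = i) (ha : a < n)
    (hb : b < n) : ∀ i, n ≤ i → (w * transp a b).1 i = i := by
  intro i hi
  rw [mul_apply, transp_apply, if_neg (by omega), if_neg (by omega), hn i hi]

open Classical in
/-- The divided difference recursion for Schubert polynomials. -/
theorem schubert_sub_swap (w : SInf) (i : ℕ) :
    schubert w - rename (Equiv.swap i (i + 1)) (schubert w) =
      (X i - X (i + 1)) * if w.1 (i + 1) < w.1 i then schubert (w * transp i (i + 1)) else 0 := by
  obtain ⟨n, hin, hn⟩ := exists_fixed_ge w (i + 2)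
  have h1 : rename (Equiv.swap i (i + 1)) (schubert w) =
      rowsProd (nilOp (MvPolynomial ℕ ℤ)) n
        (fun j => (X (Equiv.swap i (i + 1) j) : MvPolynomial ℕ ℤ)) n (unitCoeff _) w := by
    rw [schubert_eq_rowsProd hn]
    have := map_rowsProd_apply
      (rename (R := ℤ) (Equiv.swap i (i + 1)) : MvPolynomial ℕ ℤ →ₐ[ℤ] MvPolynomial ℕ ℤ).toRingHom
      X n w
    simpa using this
  have h2 := congrFun (congrArg (fun P : Module.End (MvPolynomial ℕ ℤ) (SInf → MvPolynomial ℕ ℤ) =>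
    P (unitCoeff _)) (nilCoxeter_nilOp.rowsProd_sub n (X : ℕ → MvPolynomial ℕ ℤ) i n hin le_rfl)) w
  simp only [LinearMap.sub_apply, Pi.sub_apply, LinearMap.smul_apply, Pi.smul_apply,
    Module.End.mul_apply, nilOp_apply, smul_eq_mul] at h2
  rw [h1, schubert_eq_rowsProd hn,
    schubert_eq_rowsProd (mul_transp_fixed hn (a := i) (b := i + 1) (by omega) (by omega)), h2]

theorem rename_schubert_of_not_desc {w : SInf} {i : ℕ} (h : w.1 i < w.1 (i + 1)) :
    rename (Equiv.swap i (i + 1)) (schubert w) = schubert w := by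
  have := schubert_sub_swap w i
  rw [if_neg (by omega), mul_zero, sub_eq_zero] at this
  exact this.symm

theorem rowProd_zero (n k : ℕ) : rowProd (nilOp ℤ) n (0 : ℤ) k = 1 := by
  induction k with
  | zero => rfl
  | succ k ih => rw [rowProd, ih, zero_smul, add_zero, mul_one]

theorem rowsProd_zero (n k : ℕ) : rowsProd (nilOp ℤ) n (fun _ => (0 : ℤ)) k = 1 := by
  induction k with
  | zero => rfl
  | succ k ih => rw [rowsProd, ih, rowProd_zero, mul_one]

open Classical in
theorem constantCoeff_schubert (w : SInf) :
    constantCoeff (schubert w) = if w = 1 then 1 else 0 := by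
  obtain ⟨n, hn⟩ := exists_fixed w
  rw [schubert_eq_rowsProd hn, map_rowsProd_apply]
  simp only [constantCoeff_X]
  rw [rowsProd_zero, Module.End.one_apply, unitCoeff]

/-! ### Polynomials invariant under adjacent transpositions -/

/-- If the largest variable `x_M` had `M ≥ d`, invariance under the swap of `M` and `M + 1` would
make `x_{M+1}` occur too. -/
theorem lt_of_mem_vars {f : MvPolynomial ℕ ℤ} {d : ℕ}
    (h : ∀ i, d ≤ i → rename (Equiv.swap i (i + 1)) f = f) {i : ℕ} (hi : i ∈ f.vars) : i < d := by
  by_contra hc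
  have hmax := f.vars.max'_mem ⟨i, hi⟩
  have hle : ∀ j ∈ f.vars, j ≤ f.vars.max' ⟨i, hi⟩ := fun j hj => f.vars.le_max' j hj
  have hi2 := hle i hi
  generalize f.vars.max' ⟨i, hi⟩ = M at *
  rw [← h M (by omega)] at hmax
  obtain ⟨j, hj, hjM⟩ := mem_vars_rename _ _ hmax
  rw [Equiv.swap_apply_eq_iff, Equiv.swap_apply_left] at hjM
  have := hle _ hj
  omega

/-- The tool for proving identities: it suffices to compare the changes under all adjacent swaps,
and the constant terms. -/
theorem eq_zero_of_symmetric {f : MvPolynomial ℕ ℤ}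
    (h : ∀ i, rename (Equiv.swap i (i + 1)) f = f) (h0 : constantCoeff f = 0) : f = 0 := by
  have h1 : f.vars = ∅ := by
    rw [Finset.eq_empty_iff_forall_notMem]
    intro i hi
    have := lt_of_mem_vars (d := 0) (fun i _ => h i) hi
    omega
  rw [vars_eq_empty_iff_eq_C] at h1
  rw [h1, show coeff 0 f = 0 from h0, C_0]

theorem schubert_one : schubert 1 = 1 := by
  rw [← sub_eq_zero]
  refine eq_zero_of_symmetric (fun i => ?_) ?_
  · rw [map_sub, map_one, rename_schubert_of_not_desc (by simp)]
  · rw [map_sub, constantCoeff_schubert, if_pos rfl, map_one, sub_self]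

theorem X_sub_X_ne_zero (i : ℕ) : (X i - X (i + 1) : MvPolynomial ℕ ℤ) ≠ 0 := by
  rw [sub_ne_zero, Ne, X_inj]
  omega

theorem vars_schubert_lt {w : SInf} {d : ℕ} (h : ∀ i, d ≤ i → w.1 i < w.1 (i + 1)) {i : ℕ}
    (hi : i ∈ (schubert w).vars) : i < d :=
  lt_of_mem_vars (fun i hi => rename_schubert_of_not_desc (h i hi)) hi

/-! ### Linear independence -/

/-- Induction on the length of `v`: the divided difference at a descent of `v` turns the relation
into one in which a shorter permutation carries the coefficient of `v`. -/
theorem schubert_sum_eq_zero_apply {c : SInf →₀ ℤ} (v : SInf)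
    (h : (c.sum fun v a => a • schubert v) = 0) : c v = 0 := by
  classical
  induction hl : length v generalizing c v with
  | zero =>
    rw [length_eq_zero] at hl
    subst hl
    have h1 := congrArg constantCoeff h
    rw [Finsupp.sum, map_sum, map_zero] at h1
    simp only [zsmul_eq_mul, map_mul, map_intCast, constantCoeff_schubert, mul_ite, mul_one,
      mul_zero, Finset.sum_ite_eq', Finsupp.mem_support_iff] at h1
    by_contra hc
    rw [if_pos hc] at h1
    exact hc (by simpa using h1)
  | succ n ih =>
    have hv : v ≠ 1 := by
      rintro rfl
      rw [length_one] at hl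
      omega
    obtain ⟨i, hi⟩ := exists_desc hv
    have hinj : Function.Injective (fun z : SInf => z * transp i (i + 1)) :=
      mul_left_injective _
    -- The coefficients after the divided difference: terms without a descent at `i` vanish, the
    -- others move to `z t_{i,i+1}`.
    set c' := (c.filter fun z => z.1 (i + 1) < z.1 i).mapDomain (fun z : SInf => z * transp i (i + 1))
      with hc'
    have hsum : (X i - X (i + 1)) * (c'.sum fun v a => a • schubert v) = 0 := by
      have h1 : (c.sum fun v a => a • schubert v) - rename (Equiv.swap i (i + 1))
          (c.sum fun v a => a • schubert v) = 0 := by rw [h, map_zero, sub_zero]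
      rw [← h1, hc', Finsupp.sum_mapDomain_index (by simp) (by intros; exact add_smul _ _ _),
        Finsupp.sum_filter_index]
      simp only [Finsupp.sum, map_sum, map_zsmul]
      rw [← Finset.sum_sub_distrib, Finset.mul_sum, Finsupp.support_filter, Finset.sum_filter]
      refine Finset.sum_congr rfl fun z _ => ?_
      rw [← smul_sub, schubert_sub_swap]
      split_ifs
      · rw [mul_smul_comm]
      · simp
    have hlen := length_mul_adj_of_desc hi
    have := ih (v * transp i (i + 1))
      ((mul_eq_zero.1 hsum).resolve_left (X_sub_X_ne_zero i)) (by omega)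
    rw [hc', Finsupp.mapDomain_apply hinj, Finsupp.filter_apply, if_pos hi] at this
    exact this

theorem IsSchubertExpansion.unique {f : MvPolynomial ℕ ℤ} {c c' : SInf →₀ ℤ}
    (h : IsSchubertExpansion f c) (h' : IsSchubertExpansion f c') : c = c' := by
  rw [← sub_eq_zero]
  ext v
  refine schubert_sum_eq_zero_apply v ?_
  rw [Finsupp.sum_sub_index (fun _ _ _ => sub_smul _ _ _)]
  exact sub_eq_zero.2 (h.symm.trans h')

theorem IsSchubertExpansion.schubertExpansion_eq {f : MvPolynomial ℕ ℤ} {c : SInf →₀ ℤ}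
    (h : IsSchubertExpansion f c) : schubertExpansion f = c :=
  (Classical.epsilon_spec (p := IsSchubertExpansion f) ⟨c, h⟩).unique h

/-! ### Products -/

theorem le_apply {b : SInf} {p : ℕ} (hb : ∀ i, i < p → b.1 i = i) {k : ℕ} (hk : p ≤ k) :
    p ≤ b.1 k := by
  by_contra hc
  have h1 := hb _ (not_le.1 hc)
  rw [apply_inj] at h1
  omega

theorem sub_mul_swap_left {f g : MvPolynomial ℕ ℤ} {i : ℕ}
    (h : rename (Equiv.swap i (i + 1)) g = g) :
    f * g - rename (Equiv.swap i (i + 1)) (f * g) =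
      (f - rename (Equiv.swap i (i + 1)) f) * g := by
  rw [map_mul, h, sub_mul]

/-- Each divided difference acts on only one of the factors, so induction on length shows that both
sides change in the same way under adjacent swaps. -/
theorem schubert_mul {a b : SInf} {p : ℕ} (ha : ∀ i, p ≤ i → a.1 i = i)
    (hb : ∀ i, i < p → b.1 i = i) : schubert (a * b) = schubert a * schubert b := by
  induction hn : length (a * b) using Nat.strong_induction_on generalizing a b with
  | _ n ih =>
  by_cases hab : a * b = 1
  · have hb1 : b = 1 := by
      ext i
      rcases lt_or_ge i p with h | h
      · exact hb i h
      · have h1 : (a * b).1 i = i := by rw [hab, one_apply]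
        rwa [mul_apply, ha _ (le_apply hb h)] at h1
    have ha1 : a = 1 := by rwa [hb1, mul_one] at hab
    rw [ha1, hb1, mul_one, schubert_one, mul_one]
  rw [← sub_eq_zero]
  refine eq_zero_of_symmetric (fun i => ?_) ?_
  · rw [eq_comm, ← sub_eq_zero, map_sub, sub_sub_sub_comm, sub_eq_zero]
    -- Below `p` the swap only concerns `a`, above it only `b`; across the border nothing has a
    -- descent.
    rcases lt_trichotomy (i + 1) p with hip | hip | hip
    · have e0 : (a * b).1 i = a.1 i := by rw [mul_apply, hb i (by omega)]
      have e1 : (a * b).1 (i + 1) = a.1 (i + 1) := by rw [mul_apply, hb (i + 1) hip]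
      have hbi : rename (Equiv.swap i (i + 1)) (schubert b) = schubert b := by
        refine rename_schubert_of_not_desc ?_
        rw [hb i (by omega), hb (i + 1) hip]
        omega
      rw [sub_mul_swap_left hbi, schubert_sub_swap, schubert_sub_swap, e0, e1]
      split_ifs with hd
      · have e : a * b * transp i (i + 1) = a * transp i (i + 1) * b := by
          ext k
          simp only [mul_apply, transp_apply]
          rcases lt_or_ge k p with h | h
          · rw [hb k h]
            split_ifs with h1 h2
            · rw [hb _ hip]
            · rw [hb _ (by omega)]
            · rw [hb _ h]
          · have h1 := le_apply hb h
            rw [if_neg (by omega), if_neg (by omega), if_neg (by omega), if_neg (by omega)]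
        have hlen := length_mul_adj_of_desc (w := a * b) (i := i) (by rw [e0, e1]; exact hd)
        rw [e, ih (length (a * b * transp i (i + 1))) (by omega) (a := a * transp i (i + 1))
          (mul_transp_fixed ha (by omega) hip) hb (by rw [e]), mul_assoc]
      · simp
    · have h1 : a.1 i < p := apply_lt ha (by omega)
      have h2 := le_apply hb hip.ge
      have h3 := ha _ h2
      have h4 := hb i (by omega)
      have h5 := ha _ hip.ge
      have e0 : (a * b).1 i < (a * b).1 (i + 1) := by
        rw [mul_apply, mul_apply, h3, h4]
        omega
      rw [map_mul, rename_schubert_of_not_desc e0, rename_schubert_of_not_desc (w := a) (by omega),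
        rename_schubert_of_not_desc (w := b) (by omega)]
      simp
    · have e0 : (a * b).1 i = b.1 i := by rw [mul_apply, ha _ (le_apply hb (by omega))]
      have e1 : (a * b).1 (i + 1) = b.1 (i + 1) := by
        rw [mul_apply, ha _ (le_apply hb (by omega))]
      have hai : rename (Equiv.swap i (i + 1)) (schubert a) = schubert a := by
        refine rename_schubert_of_not_desc ?_
        rw [ha i (by omega), ha (i + 1) (by omega)]
        omega
      rw [mul_comm (schubert a), sub_mul_swap_left hai, schubert_sub_swap, schubert_sub_swap, e0,
        e1]
      split_ifs with hd
      · have hlen := length_mul_adj_of_desc (w := a * b) (i := i) (by rw [e0, e1]; exact hd)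
        rw [mul_assoc a, ih (length (a * b * transp i (i + 1))) (by omega) ha
          (b := b * transp i (i + 1)) (fun k hk => ?_) (by rw [mul_assoc]), mul_assoc,
          mul_comm (schubert a)]
        rw [mul_apply, transp_apply, if_neg (by omega), if_neg (by omega), hb k hk]
      · simp
  · rw [map_sub, map_mul, constantCoeff_schubert, constantCoeff_schubert, constantCoeff_schubert,
      if_neg hab]
    by_cases h1 : a = 1
    · rw [if_neg (c := b = 1), mul_zero, sub_zero]
      rintro rfl
      exact hab (by rw [h1, mul_one])
    · rw [if_neg h1, zero_mul, sub_zero]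

/-! ### The permutations `1ⁿ × v` -/

theorem directSum_apply_lt {p : ℕ} (w : Equiv.Perm (Fin p)) (v : SInf) {i : ℕ} (h : i < p) :
    (directSum w v).1 i = w ⟨i, h⟩ := by
  simp only [directSum]
  rw [Equiv.permCongr_apply, finSumNatEquiv_symm_apply_of_lt h, Equiv.sumCongr_apply, Sum.map_inl,
    finSumNatEquiv_apply_left]

theorem directSum_apply_ge {p : ℕ} (w : Equiv.Perm (Fin p)) (v : SInf) {i : ℕ} (h : p ≤ i) :
    (directSum w v).1 i = p + v.1 (i - p) := by
  simp only [directSum]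
  rw [Equiv.permCongr_apply, finSumNatEquiv_symm_apply_of_ge h, Equiv.sumCongr_apply, Sum.map_inr,
    finSumNatEquiv_apply_right]

theorem ones_apply (n : ℕ) (v : SInf) (i : ℕ) :
    (ones n v).1 i = if i < n then i else n + v.1 (i - n) := by
  split_ifs with h
  · exact directSum_apply_lt _ _ h
  · exact directSum_apply_ge _ _ (not_lt.1 h)

theorem ones_apply_lt {n : ℕ} (v : SInf) {i : ℕ} (h : i < n) : (ones n v).1 i = i := by
  rw [ones_apply, if_pos h]

theorem ones_apply_add (n : ℕ) (v : SInf) (i : ℕ) : (ones n v).1 (n + i) = n + v.1 i := by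
  rw [ones_apply, if_neg (by omega), Nat.add_sub_cancel_left]

theorem ones_ones (a b : ℕ) (v : SInf) : ones a (ones b v) = ones (a + b) v := by
  ext i
  rw [ones_apply, ones_apply, ones_apply, Nat.sub_sub]
  split_ifs <;> omega

theorem ones_zero (v : SInf) : ones 0 v = v := by
  ext i
  simp [ones_apply]

theorem ones_one (n : ℕ) : ones n 1 = 1 := by
  ext i
  rw [ones_apply, one_apply, one_apply]
  split_ifs <;> omega

theorem ones_injective (n : ℕ) : Function.Injective (ones n) := by
  intro v v' h
  ext i
  have := congrArg (fun z : SInf => z.1 (n + i)) h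
  simp only [ones_apply_add] at this
  omega

theorem ones_mul_transp (n : ℕ) (v : SInf) (i j : ℕ) :
    ones n (v * transp i j) = ones n v * transp (n + i) (n + j) := by
  ext k
  simp only [mul_apply, ones_apply, transp_apply]
  grind

theorem exists_eq_ones {n : ℕ} {z : SInf} (h : ∀ i, i < n → z.1 i = i) : ∃ v, z = ones n v := by
  have hinv : ∀ i, i < n → (z⁻¹).1 i = i := fun i hi => by
    have h1 : z⁻¹.1 (z.1 i) = i := z.1.symm_apply_apply i
    rwa [h i hi] at h1
  have hle : ∀ i, n ≤ z.1 (n + i) := fun i => le_apply h (by omega)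
  have hle' : ∀ i, n ≤ z⁻¹.1 (n + i) := fun i => le_apply hinv (by omega)
  let e : Equiv.Perm ℕ :=
    { toFun := fun i => z.1 (n + i) - n
      invFun := fun i => z⁻¹.1 (n + i) - n
      left_inv := fun i => by
        dsimp only
        rw [Nat.add_sub_cancel' (hle i), show z⁻¹.1 (z.1 (n + i)) = n + i from
          z.1.symm_apply_apply _, Nat.add_sub_cancel_left]
      right_inv := fun i => by
        dsimp only
        rw [Nat.add_sub_cancel' (hle' i), show z.1 (z⁻¹.1 (n + i)) = n + i from
          z.1.apply_symm_apply _, Nat.add_sub_cancel_left] }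
  have he : e ∈ SInf := by
    obtain ⟨N, hN⟩ := exists_fixed z
    refine (Set.finite_lt_nat N).subset fun i hi => ?_
    by_contra hc
    apply hi
    have hc : N ≤ i := not_lt.1 hc
    change z.1 (n + i) - n = i
    rw [hN _ (by omega), Nat.add_sub_cancel_left]
  refine ⟨⟨e, he⟩, ?_⟩
  ext i
  rw [ones_apply]
  split_ifs with hi
  · exact h i hi
  · change z.1 i = n + (z.1 (n + (i - n)) - n)
    rw [Nat.add_sub_cancel' (hle _), Nat.add_sub_cancel' (not_lt.1 hi)]

/-! ### Setting variables to zero -/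

/-- Set `x_j = 0` and close the gap. -/
noncomputable def delVar (j : ℕ) : MvPolynomial ℕ ℤ →ₐ[ℤ] MvPolynomial ℕ ℤ :=
  aeval fun i => if i < j then X i else if i = j then 0 else X (i - 1)

/-- Set the variables `x_d, x_{d+1}, …` to zero. -/
noncomputable def trunc (d : ℕ) : MvPolynomial ℕ ℤ →ₐ[ℤ] MvPolynomial ℕ ℤ :=
  aeval fun i => if i < d then X i else 0

theorem delVar_X (j i : ℕ) :
    delVar j (X i) = if i < j then X i else if i = j then 0 else X (i - 1) := aeval_X _ _

theorem trunc_X (d i : ℕ) : trunc d (X i) = if i < d then X i else 0 := aeval_X _ _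

theorem delVar_zero_rename (i : ℕ) (f : MvPolynomial ℕ ℤ) :
    delVar 0 (rename (Equiv.swap (i + 1) (i + 1 + 1)) f) =
      rename (Equiv.swap i (i + 1)) (delVar 0 f) := by
  suffices h : (delVar 0).comp (rename (Equiv.swap (i + 1) (i + 1 + 1))) =
      (rename (Equiv.swap i (i + 1))).comp (delVar 0) from DFunLike.congr_fun h f
  refine algHom_ext fun k => ?_
  simp only [AlgHom.comp_apply, rename_X, delVar_X, Equiv.swap_apply_def]
  rcases k with _ | k
  · simp
  · rw [if_neg (Nat.not_lt_zero (k + 1)), if_neg (Nat.succ_ne_zero k), rename_X,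
      Equiv.swap_apply_def]
    by_cases h1 : k = i
    · subst h1
      simp
    · by_cases h2 : k = i + 1
      · subst h2
        simp
      · simp [h1, h2]

theorem delVar_succ (j : ℕ) {f : MvPolynomial ℕ ℤ} (h : rename (Equiv.swap j (j + 1)) f = f) :
    delVar (j + 1) f = delVar j f := by
  conv_rhs => rw [← h]
  suffices h : delVar (j + 1) = (delVar j).comp (rename (Equiv.swap j (j + 1))) from
    DFunLike.congr_fun h f
  refine algHom_ext fun k => ?_
  simp only [AlgHom.comp_apply, rename_X, delVar_X, Equiv.swap_apply_def]
  split_ifs <;> first | rfl | omega | exact congrArg X (by omega)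

theorem delVar_eq {d : ℕ} {f : MvPolynomial ℕ ℤ}
    (h : ∀ i, i < d → rename (Equiv.swap i (i + 1)) f = f) : delVar d f = delVar 0 f := by
  induction d with
  | zero => rfl
  | succ d ih => rw [delVar_succ d (h d (by omega)), ih fun i hi => h i (by omega)]

theorem trunc_delVar (d : ℕ) (f : MvPolynomial ℕ ℤ) : trunc d (delVar d f) = trunc d f := by
  suffices h : (trunc d).comp (delVar d) = trunc d from DFunLike.congr_fun h f
  refine algHom_ext fun k => ?_
  simp only [AlgHom.comp_apply, trunc_X, delVar_X]
  split_ifs with h1 h2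
  · simp [trunc_X, h1]
  · simp
  · rw [trunc_X, if_neg (by omega)]

theorem trunc_of_vars {d : ℕ} {f : MvPolynomial ℕ ℤ} (h : ∀ i ∈ f.vars, i < d) :
    trunc d f = f := by
  conv_rhs => rw [← aeval_X_left_apply f]
  refine eval₂Hom_congr' rfl (fun i hi _ => ?_) rfl
  rw [if_pos (h i hi)]

theorem coeff_trunc {d : ℕ} (f : MvPolynomial ℕ ℤ) {e : ℕ →₀ ℕ} (he : ∀ i ∈ e.support, i < d) :
    coeff e (trunc d f) = coeff e f := by
  classical
  induction f using MvPolynomial.induction_on' with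
  | add p q hp hq => rw [map_add, coeff_add, coeff_add, hp, hq]
  | monomial u a =>
    by_cases hu : ∀ i ∈ u.support, i < d
    · rw [trunc_of_vars]
      intro i hi
      by_cases ha : a = 0
      · simp [ha] at hi
      · rw [vars_monomial ha] at hi
        exact hu i hi
    · push Not at hu
      obtain ⟨i, hi, hid⟩ := hu
      have h0 : trunc d (monomial u a) = 0 := by
        rw [trunc, aeval_monomial, Finsupp.prod, Finset.prod_eq_zero hi, mul_zero]
        rw [if_neg (by omega), zero_pow (Finsupp.mem_support_iff.1 hi)]
      rw [h0, coeff_zero, coeff_monomial, if_neg]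
      rintro rfl
      have := he i hi
      omega

theorem ones_one_desc (v : SInf) (i : ℕ) :
    (ones 1 v).1 (i + 1 + 1) < (ones 1 v).1 (i + 1) ↔ v.1 (i + 1) < v.1 i := by
  rw [add_comm (i + 1) 1, add_comm i 1, ones_apply_add, ones_apply_add]
  omega

theorem constantCoeff_delVar_zero (f : MvPolynomial ℕ ℤ) :
    constantCoeff (delVar 0 f) = constantCoeff f := by
  suffices h : constantCoeff.comp (delVar 0).toRingHom = constantCoeff from DFunLike.congr_fun h f
  refine ringHom_ext (fun a => ?_) fun i => ?_
  · simp
  · simp only [AlgHom.toRingHom_eq_coe, RingHom.coe_comp, RingHom.coe_coe, Function.comp_apply,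
      delVar_X]
    split_ifs <;> simp

/-- Deleting `x_0` turns the divided difference at `i + 1` into that at `i`, and the descents of `1
× v` correspond to those of `v` in the same way. -/
theorem delVar_zero_schubert_ones (v : SInf) : delVar 0 (schubert (ones 1 v)) = schubert v := by
  induction hn : length v using Nat.strong_induction_on generalizing v with
  | _ n ih =>
  by_cases hv : v = 1
  · rw [hv, ones_one, schubert_one, map_one]
  rw [← sub_eq_zero]
  refine eq_zero_of_symmetric (fun i => ?_) ?_
  · rw [eq_comm, ← sub_eq_zero, map_sub, sub_sub_sub_comm, sub_eq_zero, ← delVar_zero_rename,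
      ← map_sub, schubert_sub_swap, schubert_sub_swap]
    simp only [ones_one_desc]
    split_ifs with hd
    · have hlen := length_mul_adj_of_desc hd
      have := ih (length (v * transp i (i + 1))) (by omega) (v * transp i (i + 1)) rfl
      rw [map_mul, map_sub, delVar_X, delVar_X, ← this, ones_mul_transp, add_comm 1, add_comm 1]
      simp
    · simp
  · rw [map_sub, constantCoeff_delVar_zero, constantCoeff_schubert, constantCoeff_schubert, if_neg hv, if_neg, sub_zero]
    intro h
    exact hv (ones_injective 1 (h.trans (ones_one 1).symm))

/-- Only the divided differences at `i + 1 ≥ 1` are needed. They leave the value at position `0`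
alone, so the hypothesis persists in the induction. -/
theorem delVar_zero_schubert_of_ne {z : SInf} (hz : z.1 0 ≠ 0) : delVar 0 (schubert z) = 0 := by
  induction hn : length z using Nat.strong_induction_on generalizing z with
  | _ n ih =>
  refine eq_zero_of_symmetric (fun i => ?_) ?_
  · rw [eq_comm, ← sub_eq_zero, ← delVar_zero_rename, ← map_sub, schubert_sub_swap]
    split_ifs with hd
    · have hlen := length_mul_adj_of_desc hd
      rw [map_mul, ih (length (z * transp (i + 1) (i + 1 + 1))) (by omega) ?_ rfl, mul_zero]
      rw [mul_apply, transp_apply, if_neg (by omega), if_neg (by omega)]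
      exact hz
    · simp
  · rw [constantCoeff_delVar_zero, constantCoeff_schubert, if_neg]
    rintro rfl
    exact hz rfl

/-- Stability of Schubert polynomials in few variables. -/
theorem trunc_schubert_ones_one {v : SInf} {d : ℕ} (h : ∀ i, i + 1 < d → v.1 i < v.1 (i + 1)) :
    trunc d (schubert (ones 1 v)) = trunc d (schubert v) := by
  -- The polynomial of `1 × v` is symmetric in `x_0, …, x_d`, so deleting `x_0` amounts to deleting
  -- `x_d`, which truncation does not notice.
  rw [← delVar_zero_schubert_ones v, ← trunc_delVar, delVar_eq]
  intro i hi
  refine rename_schubert_of_not_desc ?_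
  rcases i with _ | i
  · rw [ones_apply, ones_apply]
    simp
  · have := h i hi
    exact (lt_or_desc _ _).resolve_right fun hd => by
      rw [ones_one_desc] at hd
      omega

theorem trunc_schubert_ones {v : SInf} {d : ℕ} (h : ∀ i, i + 1 < d → v.1 i < v.1 (i + 1)) (p : ℕ) :
    trunc d (schubert (ones p v)) = trunc d (schubert v) := by
  induction p with
  | zero => rw [ones_zero]
  | succ p ih =>
    rw [add_comm p 1, ← ones_ones, trunc_schubert_ones_one, ih]
    intro i hi
    rw [ones_apply, ones_apply]
    split_ifs
    · omega
    · omega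
    · omega
    · have := h (i - p) (by omega)
      rw [show i + 1 - p = i - p + 1 by omega]
      omega

/-! ### Monk's formula -/

theorem swap_fun (i c : ℕ) : Equiv.swap i (i + 1) c = if c = i then i + 1 else if c = i + 1 then i else c :=
  Equiv.swap_apply_def _ _ _

theorem mul_transp_conj (w : SInf) (a b i : ℕ) : w * transp a b * transp i (i + 1) =
    w * transp i (i + 1) * transp (Equiv.swap i (i + 1) a) (Equiv.swap i (i + 1) b) := by
  have h := Equiv.swap_apply_apply (Equiv.swap i (i + 1)) a b
  refine Subtype.ext ?_
  change w.1 * Equiv.swap a b * Equiv.swap i (i + 1) = w.1 * Equiv.swap i (i + 1) * Equiv.swap _ _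
  rw [h, Equiv.swap_inv]
  simp only [mul_assoc, Equiv.swap_mul_self_mul]

theorem apply_ne (w : SInf) (i j : ℕ) : i = j ∨ w.1 i ≠ w.1 j := by
  rw [Ne, apply_inj]
  exact em _

/-- Matches the terms of Monk's formula for `w` that survive a divided difference with the terms for
`w t_{i,i+1}`; the excluded pair is treated in `covTerm_adj_sub_swap`. -/
theorem cov_and_desc_iff {w : SInf} {a b i : ℕ} (hab : a < b) (hne : ¬ (a = i ∧ b = i + 1)) :
    (Cov w a b ∧ (w * transp a b).1 (i + 1) < (w * transp a b).1 i) ↔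
      (w.1 (i + 1) < w.1 i ∧
        Cov (w * transp i (i + 1)) (Equiv.swap i (i + 1) a) (Equiv.swap i (i + 1) b)) := by
  have d1 := apply_ne w a i
  have d2 := apply_ne w a (i + 1)
  have d3 := apply_ne w b i
  have d4 := apply_ne w b (i + 1)
  have d5 := apply_ne w i (i + 1)
  have d6 := apply_ne w a b
  simp only [Cov, mul_apply, transp_apply, swap_fun]
  constructor
  · rintro ⟨⟨-, h2, h3⟩, h4⟩
    have hi := h3 i
    have hi1 := h3 (i + 1)
    refine ⟨?_, ?_, ?_, fun c hc1 hc2 => ?_⟩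
    · grind
    · grind
    · grind
    · have hc := h3 c
      grind
  · rintro ⟨h4, ⟨-, h2, h3⟩⟩
    have hi := h3 i
    have hi1 := h3 (i + 1)
    refine ⟨⟨hab, ?_, fun c hc1 hc2 => ?_⟩, ?_⟩
    · grind
    · have hc := h3 c
      grind
    · grind

open Classical in
/-- The Schubert polynomial of `w t_{ab}` if this covers `w`. -/
noncomputable def covTerm (w : SInf) (a b : ℕ) : MvPolynomial ℕ ℤ :=
  if Cov w a b then schubert (w * transp a b) else 0

theorem covTerm_of_le {w : SInf} {a b : ℕ} (h : b ≤ a) : covTerm w a b = 0 :=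
  if_neg fun h' => absurd h'.1 (not_lt.2 h)

open Classical in
theorem covTerm_sub_swap {w : SInf} {a b i : ℕ} (h1 : ¬ (a = i ∧ b = i + 1))
    (h2 : ¬ (b = i ∧ a = i + 1)) :
    covTerm w a b - rename (Equiv.swap i (i + 1)) (covTerm w a b) = (X i - X (i + 1)) *
      if w.1 (i + 1) < w.1 i then
        covTerm (w * transp i (i + 1)) (Equiv.swap i (i + 1) a) (Equiv.swap i (i + 1) b) else 0 := by
  rcases lt_or_ge a b with hab | hab
  · have key := cov_and_desc_iff (w := w) hab h1
    unfold covTerm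
    by_cases hc : Cov w a b
    · rw [if_pos hc, schubert_sub_swap, mul_transp_conj]
      by_cases hd : (w * transp a b).1 (i + 1) < (w * transp a b).1 i
      · have h := key.1 ⟨hc, hd⟩
        rw [if_pos hd, if_pos h.1, if_pos h.2]
      · rw [if_neg hd]
        split_ifs with h3 h4
        · exact absurd (key.2 ⟨h3, h4⟩).2 hd
        · rfl
        · rfl
    · rw [if_neg hc]
      split_ifs with h3 h4
      · exact absurd (key.2 ⟨h3, h4⟩).1 hc
      · simp
      · simp
  · have hab' : Equiv.swap i (i + 1) b ≤ Equiv.swap i (i + 1) a := by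
      rw [swap_fun, swap_fun]
      split_ifs <;> omega
    rw [covTerm_of_le hab, covTerm_of_le hab']
    simp

open Classical in
-- The extra term `schubert w` is what will match the divided difference of the variable in the
-- product rule.
theorem covTerm_adj_sub_swap (w : SInf) (i : ℕ) :
    covTerm w i (i + 1) - rename (Equiv.swap i (i + 1)) (covTerm w i (i + 1)) =
      (X i - X (i + 1)) * (schubert w -
        if w.1 (i + 1) < w.1 i then covTerm (w * transp i (i + 1)) i (i + 1) else 0) := by
  have hcov : ∀ z : SInf, Cov z i (i + 1) ↔ z.1 i < z.1 (i + 1) := fun z =>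
    ⟨fun h => h.2.1, fun h => ⟨by omega, h, fun c _ _ => by omega⟩⟩
  have e0 : (w * transp i (i + 1)).1 i = w.1 (i + 1) := by simp [transp_apply]
  have e1 : (w * transp i (i + 1)).1 (i + 1) = w.1 i := by simp [transp_apply]
  unfold covTerm
  simp only [hcov]
  rw [e0, e1, mul_transp_cancel]
  rcases lt_or_desc w i with h | h
  · rw [if_pos h, if_neg (not_lt.2 h.le), sub_zero, schubert_sub_swap, e0, e1, if_pos h,
      mul_transp_cancel]
  · rw [if_neg (not_lt.2 h.le), if_pos h, if_pos h]
    simp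

/-- The terms of Monk's formula. -/
noncomputable def monkTerm (w : SInf) (r k : ℕ) : MvPolynomial ℕ ℤ := covTerm w r k - covTerm w k r

open Classical in
theorem monkTerm_sub_swap (w : SInf) (r k i : ℕ) :
    monkTerm w r k - rename (Equiv.swap i (i + 1)) (monkTerm w r k) = (X i - X (i + 1)) *
      (((if r = i ∧ k = i + 1 then schubert w else 0) -
        (if r = i + 1 ∧ k = i then schubert w else 0)) +
      if w.1 (i + 1) < w.1 i then
        monkTerm (w * transp i (i + 1)) (Equiv.swap i (i + 1) r) (Equiv.swap i (i + 1) k) else 0) := by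
  unfold monkTerm
  rw [map_sub, sub_sub_sub_comm]
  by_cases h1 : r = i ∧ k = i + 1
  · obtain ⟨rfl, rfl⟩ := h1
    rw [covTerm_adj_sub_swap, covTerm_of_le (w := w) (a := r + 1) (by omega), Equiv.swap_apply_left,
      Equiv.swap_apply_right, covTerm_of_le (w := w * transp r (r + 1)) (a := r + 1) (by omega)]
    simp only [and_self, if_true, Nat.left_eq_add, one_ne_zero, false_and, if_false, map_zero]
    split_ifs <;> ring
  by_cases h2 : r = i + 1 ∧ k = i
  · obtain ⟨rfl, rfl⟩ := h2
    rw [covTerm_adj_sub_swap, covTerm_of_le (w := w) (a := k + 1) (by omega), Equiv.swap_apply_left,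
      Equiv.swap_apply_right, covTerm_of_le (w := w * transp k (k + 1)) (a := k + 1) (by omega)]
    simp
    split_ifs <;> ring
  rw [if_neg h1, if_neg h2, covTerm_sub_swap h1 (by omega), covTerm_sub_swap (by omega) (by omega)]
  split_ifs <;> ring

theorem monkTerm_rename {w : SInf} {r k n i : ℕ} (hn : ∀ i, n ≤ i → w.1 i = i) (hr : r < n)
    (hk : k < n) (hi : n ≤ i + 1) :
    rename (Equiv.swap i (i + 1)) (monkTerm w r k) = monkTerm w r k := by
  have key : ∀ a b, a < n → b < n →
      rename (Equiv.swap i (i + 1)) (covTerm w a b) = covTerm w a b := by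
    intro a b ha hb
    unfold covTerm
    split_ifs
    · refine rename_schubert_of_not_desc ?_
      have h1 := mul_transp_fixed hn ha hb
      rw [h1 (i + 1) hi]
      rcases lt_or_ge i n with h | h
      · have := apply_lt h1 h
        omega
      · rw [h1 i h]
        omega
    · exact map_zero _
  rw [monkTerm, map_sub, key r k hr hk, key k r hk hr]

/-- Both sides satisfy the same product rule for divided differences, so induction on length
applies. The bound `n` exceeds the support of `w` by one, to include the first position beyond it.
-/
theorem X_mul_schubert {w : SInf} {r n : ℕ} (hr : r + 1 < n) (hn : ∀ i, n ≤ i + 1 → w.1 i = i) :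
    X r * schubert w = ∑ k ∈ Finset.range n, monkTerm w r k := by
  induction hl : length w using Nat.strong_induction_on generalizing w r with
  | _ l ih =>
  have hn' : ∀ i, n ≤ i → w.1 i = i := fun i hi => hn i (by omega)
  rw [← sub_eq_zero]
  refine eq_zero_of_symmetric (fun i => ?_) ?_
  · rw [eq_comm, ← sub_eq_zero, map_sub, map_sum, sub_sub_sub_comm, ← Finset.sum_sub_distrib,
      sub_eq_zero, map_mul, rename_X]
    rcases lt_or_ge (i + 1) n with hi | hi
    · have e : (X r * schubert w - X (Equiv.swap i (i + 1) r) *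
          rename (Equiv.swap i (i + 1)) (schubert w) : MvPolynomial ℕ ℤ) =
          (X r - X (Equiv.swap i (i + 1) r)) * schubert w + X (Equiv.swap i (i + 1) r) *
          (schubert w - rename (Equiv.swap i (i + 1)) (schubert w)) := by ring
      have e2 : (X r - X (Equiv.swap i (i + 1) r) : MvPolynomial ℕ ℤ) * schubert w =
          (X i - X (i + 1)) * ∑ k ∈ Finset.range n, ((if r = i ∧ k = i + 1 then schubert w else 0) -
            (if r = i + 1 ∧ k = i then schubert w else 0)) := by
        rw [Finset.sum_sub_distrib]
        have hi1 : i + 1 ∈ Finset.range n := Finset.mem_range.2 hi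
        have hi0 : i ∈ Finset.range n := Finset.mem_range.2 (by omega)
        by_cases h1 : r = i
        · subst h1
          simp only [true_and, Finset.sum_ite_eq', if_pos hi1, Equiv.swap_apply_left]
          simp
        · by_cases h2 : r = i + 1
          · subst h2
            simp only [true_and, Finset.sum_ite_eq', if_pos hi0, Equiv.swap_apply_right]
            simp
            ring
          · rw [Equiv.swap_apply_of_ne_of_ne h1 h2]
            simp [h1, h2]
      rw [e, e2, schubert_sub_swap, Finset.sum_congr rfl fun k _ => monkTerm_sub_swap w r k i,
        ← Finset.mul_sum, Finset.sum_add_distrib, mul_add]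
      congr 1
      rw [mul_left_comm]
      congr 1
      by_cases hd : w.1 (i + 1) < w.1 i
      · simp only [if_pos hd]
        have hlen := length_mul_adj_of_desc hd
        -- Position `n - 1` is fixed and hence not part of a descent, so the bound `n` also serves
        -- for `w t_{i,i+1}`.
        have hin : i + 2 < n := by
          by_contra hc
          have h1 := hn (i + 1) (by omega)
          have h2 := apply_lt (n := i + 1) (x := w) (fun j hj => hn j (by omega)) (i := i) (by omega)
          omega
        rw [ih (length (w * transp i (i + 1))) (by omega)
          (w := w * transp i (i + 1)) (r := Equiv.swap i (i + 1) r) ?_ (fun j hj => ?_) rfl]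
        · refine (Finset.sum_equiv (Equiv.swap i (i + 1)) (fun j => ?_) fun _ _ => rfl).symm
          simp only [Finset.mem_range, swap_fun]
          split_ifs <;> omega
        · rw [swap_fun]
          split_ifs <;> omega
        · rw [mul_apply, transp_apply, if_neg (by omega), if_neg (by omega), hn j hj]
      · simp only [if_neg hd, mul_zero, Finset.sum_const_zero]
    · rw [Finset.sum_eq_zero fun k hk => ?_, rename_schubert_of_not_desc,
        Equiv.swap_apply_of_ne_of_ne (by omega) (by omega), sub_self]
      · rw [hn i hi, hn (i + 1) (by omega)]
        omega
      · rw [monkTerm_rename hn' (by omega) (Finset.mem_range.1 hk) hi, sub_self]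
  · have key : ∀ a b, constantCoeff (covTerm w a b) = 0 := by
      intro a b
      unfold covTerm
      split_ifs with h
      · rw [constantCoeff_schubert, if_neg]
        intro h1
        have := h.length_eq
        rw [h1, length_one] at this
        omega
      · exact map_zero _
    rw [map_sub, map_mul, constantCoeff_X, zero_mul, map_sum, zero_sub, neg_eq_zero]
    refine Finset.sum_eq_zero fun k _ => ?_
    rw [monkTerm, map_sub, key, key, sub_zero]

/-! ### Transitions -/

theorem mul_transp_left (x : SInf) (a b : ℕ) : (x * transp a b).1 a = x.1 b := by
  simp [transp_apply]

theorem mul_transp_right (x : SInf) (a b : ℕ) : (x * transp a b).1 b = x.1 a := by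
  simp [transp_apply]

theorem mul_transp_of_ne (x : SInf) {a b k : ℕ} (h1 : k ≠ a) (h2 : k ≠ b) :
    (x * transp a b).1 k = x.1 k := by
  rw [mul_apply, transp_apply, if_neg h1, if_neg h2]

/-- `r` is the largest descent of `x`, and `s` the largest position with `x s < x r`. -/
structure IsMaxTransition (x : SInf) (r s : ℕ) : Prop where
  desc : IsGreatest (descents x) r
  pos : IsGreatest {s | x.1 s < x.1 r} s

namespace IsMaxTransition

variable {x : SInf} {r s : ℕ}

theorem lt (h : IsMaxTransition x r s) : r < s := by
  have h1 : r + 1 ≤ s := h.pos.2 h.desc.1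
  omega

theorem apply_lt (h : IsMaxTransition x r s) : x.1 s < x.1 r := h.pos.1

theorem no_desc (h : IsMaxTransition x r s) {i : ℕ} (hi : r < i) : x.1 i < x.1 (i + 1) := by
  refine (lt_or_desc x i).resolve_right fun hd => ?_
  have : i ≤ r := h.desc.2 hd
  omega

theorem increasing (h : IsMaxTransition x r s) {i k : ℕ} (hi : r < i) (hk : i < k) : x.1 i < x.1 k :=
  lt_of_no_desc (n := r + 1) (fun _ hi => h.no_desc hi) hi hk

theorem le_of_lt (h : IsMaxTransition x r s) {k : ℕ} (hk : x.1 k < x.1 r) : k ≤ s := h.pos.2 hk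

/-- After the exchange, position `r` holds `x s`. Positions between `r` and `s` hold smaller values;
beyond `s`, the value `x r` at `s` lies in between and prevents a cover. -/
theorem cov_iff (h : IsMaxTransition x r s) {k : ℕ} (hk : r < k) : Cov (x * transp r s) r k ↔ k = s := by
  have hrs := h.lt
  have hsr := h.apply_lt
  constructor
  · rintro ⟨-, h1, h2⟩
    by_contra hks
    rw [mul_transp_left, mul_transp_of_ne _ (by omega) hks] at h1
    rcases lt_trichotomy k s with h3 | h3 | h3
    · have := h.increasing hk h3
      omega
    · exact hks h3
    · have h4 := h2 s hrs h3
      rw [mul_transp_left, mul_transp_right, mul_transp_of_ne _ (by omega) hks] at h4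
      have h5 : ¬ x.1 k < x.1 r := fun h6 => by
        have := h.le_of_lt h6
        omega
      have h6 := apply_ne x k r
      omega
  · rintro rfl
    refine ⟨hk, ?_, fun c h1 h2 => Or.inl ?_⟩
    · rwa [mul_transp_left, mul_transp_right]
    · rw [mul_transp_left, mul_transp_of_ne _ (by omega) (by omega)]
      exact h.increasing h1 h2

theorem length_eq (h : IsMaxTransition x r s) : length x = length (x * transp r s) + 1 := by
  have := ((h.cov_iff h.lt).2 rfl).length_eq
  rwa [mul_transp_cancel] at this

open Classical in
-- Monk's formula for `x t_{rs}` at position `r`: by `cov_iff`, `x` itself is the only cover that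
-- uses a position to the right of `r`.
theorem schubert_eq (h : IsMaxTransition x r s) : schubert x = X r * schubert (x * transp r s) +
    ∑ j ∈ (Finset.range r).filter fun j => Cov (x * transp r s) j r,
      schubert (x * transp r s * transp j r) := by
  have hrs := h.lt
  obtain ⟨n, hn, hfix⟩ := exists_fixed_ge (x * transp r s) (s + 1)
  rw [X_mul_schubert (n := n + 1) (by omega) fun i hi => hfix i (by omega)]
  simp only [monkTerm]
  rw [Finset.sum_sub_distrib]
  have h1 : ∑ k ∈ Finset.range (n + 1), covTerm (x * transp r s) r k = schubert x := by
    rw [Finset.sum_eq_single s]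
    · rw [covTerm, if_pos ((h.cov_iff hrs).2 rfl), mul_transp_cancel]
    · intro k _ hks
      rcases le_or_gt k r with hk | hk
      · exact covTerm_of_le hk
      · exact if_neg fun hc => hks ((h.cov_iff hk).1 hc)
    · intro hs
      rw [Finset.mem_range] at hs
      omega
  have h2 : ∑ k ∈ Finset.range (n + 1), covTerm (x * transp r s) k r =
      ∑ j ∈ (Finset.range r).filter fun j => Cov (x * transp r s) j r,
      schubert (x * transp r s * transp j r) := by
    simp only [covTerm]
    rw [← Finset.sum_filter]
    refine Finset.sum_congr (Finset.ext fun k => ?_) fun _ _ => rfl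
    simp only [Finset.mem_filter, Finset.mem_range]
    constructor
    · exact fun hk => ⟨hk.2.1, hk.2⟩
    · exact fun hk => ⟨by omega, hk.2⟩
  rw [h1, h2]
  ring

theorem isMTMove_iff (h : IsMaxTransition x r s) {y : SInf} : IsMTMove x y ↔
    ∃ j, Cov (x * transp r s) j r ∧ y = x * transp r s * transp j r := by
  constructor
  · rintro ⟨r', s', j, h1, h2, h3, h4, h5⟩
    obtain rfl := h1.unique h.desc
    obtain rfl := h2.unique h.pos
    refine ⟨j, cov_of_length_eq h3 ?_, h4⟩
    rw [← h4, h5, h.length_eq]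
  · rintro ⟨j, h1, h2⟩
    exact ⟨r, s, j, h.desc, h.pos, h1.1, h2, by rw [h2, h1.length_eq, h.length_eq]⟩

end IsMaxTransition

theorem exists_isMaxTransition {x : SInf} (hx : (descents x).Nonempty) :
    ∃ r s, IsMaxTransition x r s := by
  obtain ⟨n, hn⟩ := exists_fixed x
  have hb : BddAbove (descents x) := ⟨n, fun i hi => by
    have := inversion_lt hn (Nat.lt_succ_self i) hi
    omega⟩
  obtain ⟨r, hr⟩ := hb.exists_isGreatest_of_nonempty hx
  have hb2 : BddAbove {s | x.1 s < x.1 r} := ⟨max r n, fun s hs => by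
    by_contra hc
    have h1 := inversion_lt hn (show r < s by omega) hs
    omega⟩
  obtain ⟨s, hs⟩ := hb2.exists_isGreatest_of_nonempty ⟨r + 1, hr.1⟩
  exact ⟨r, s, hr, hs⟩

/-! ### The nonempty rows of the diagram -/

/-- The nonempty rows of the diagram from row `N` on. -/
def rowsFrom (N : ℕ) (x : SInf) : Set ℕ := {i | N ≤ i ∧ ∃ k, i < k ∧ x.1 k < x.1 i}

theorem finite_rowsFrom (N : ℕ) (x : SInf) : (rowsFrom N x).Finite := by
  obtain ⟨n, hn⟩ := exists_fixed x
  refine (Set.finite_lt_nat n).subset ?_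
  rintro i ⟨-, k, h1, h2⟩
  exact h1.trans (inversion_lt hn h1 h2)

theorem le_of_inversion {x : SInf} {K i k : ℕ} (hK : ∀ i, i < K → x.1 i = i) (hik : i < k)
    (h : x.1 k < x.1 i) : K ≤ i := by
  by_contra hc
  have h1 := hK i (by omega)
  rcases lt_or_ge k K with h2 | h2
  · have := hK k h2
    omega
  · have := le_apply hK h2
    omega

theorem boxesInFirstRows_iff {N : ℕ} {x : SInf} :
    BoxesInFirstRows N x ↔ ∀ i, N ≤ i → x.1 i < x.1 (i + 1) := by
  constructor
  · intro h i hi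
    refine (lt_or_desc x i).resolve_right fun hd => ?_
    have := h (i, x.1 (i + 1)) ⟨i + 1, Nat.lt_succ_self i, hd, rfl⟩
    dsimp only at this
    omega
  · rintro h ⟨i, c⟩ ⟨k, h1, h2, -⟩
    by_contra hc
    have := lt_of_no_desc h (not_lt.1 hc) h1
    exact lt_asymm this h2

/-- `x` begins with at least as many fixed points as its diagram has nonempty rows from `N` on,
plus `e`. -/
def HasRoom (N e : ℕ) (x : SInf) : Prop :=
  ∃ K, (∀ i, i < K → x.1 i = i) ∧ (rowsFrom N x).ncard + e ≤ K ∧ K ≤ N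

theorem HasRoom.fixed {N e : ℕ} {x : SInf} (h : HasRoom N e x) {i : ℕ} (hi : i < e) :
    x.1 i = i := by
  obtain ⟨K, h1, h2, -⟩ := h
  exact h1 i (by omega)

namespace IsMaxTransition

variable {x : SInf} {r s : ℕ}

theorem apply_move (h : IsMaxTransition x r s) {j : ℕ} (hj : j < r) (k : ℕ) :
    (x * transp r s * transp j r).1 k =
      if k = j then x.1 s else if k = r then x.1 j else if k = s then x.1 r else x.1 k := by
  have := h.lt
  simp only [mul_apply, transp_apply]
  split_ifs <;> first | rfl | omega

theorem cov_left_iff (h : IsMaxTransition x r s) {j : ℕ} : Cov (x * transp r s) j r ↔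
    j < r ∧ x.1 j < x.1 s ∧ ∀ c, j < c → c < r → x.1 c < x.1 j ∨ x.1 s < x.1 c := by
  have hrs := h.lt
  unfold Cov
  rw [mul_transp_left]
  constructor
  · rintro ⟨h1, h2, h3⟩
    rw [mul_transp_of_ne _ (by omega) (by omega)] at h2
    refine ⟨h1, h2, fun c hc1 hc2 => ?_⟩
    have := h3 c hc1 hc2
    rwa [mul_transp_of_ne _ (by omega) (by omega), mul_transp_of_ne _ (by omega) (by omega)] at this
  · rintro ⟨h1, h2, h3⟩
    refine ⟨h1, by rwa [mul_transp_of_ne _ (by omega) (by omega)], fun c hc1 hc2 => ?_⟩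
    rw [mul_transp_of_ne _ (by omega) (by omega), mul_transp_of_ne _ (by omega) (by omega)]
    exact h3 c hc1 hc2

theorem no_desc_move (h : IsMaxTransition x r s) {j : ℕ} (hj : j < r) {i : ℕ} (hi : r < i) :
    (x * transp r s * transp j r).1 i < (x * transp r s * transp j r).1 (i + 1) := by
  have hrs := h.lt
  have hsr := h.apply_lt
  have h1 := h.no_desc hi
  rw [h.apply_move hj, h.apply_move hj]
  have h2 : ¬ x.1 (s + 1) < x.1 r := fun h3 => by
    have := h.le_of_lt h3
    omega
  have h3 := apply_ne x (s + 1) r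
  by_cases h4 : i = s
  · subst h4
    split_ifs <;> omega
  · by_cases h5 : i + 1 = s
    · subst h5
      split_ifs <;> omega
    · split_ifs <;> omega

theorem rowsFrom_move_subset (h : IsMaxTransition x r s) {N j : ℕ} (hN : N ≤ r)
    (hj : Cov (x * transp r s) j r) {i : ℕ} (hij : i ≠ j)
    (hi : i ∈ rowsFrom N (x * transp r s * transp j r)) : i ∈ rowsFrom N x := by
  obtain ⟨hNi, k, hik, hk⟩ := hi
  have hrs := h.lt
  have hsr := h.apply_lt
  obtain ⟨hjr, hjs, hc⟩ := h.cov_left_iff.1 hj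
  have hir : i ≤ r := by
    by_contra hir
    have := lt_of_no_desc (n := r + 1) (fun _ hi => h.no_desc_move hjr hi) (not_le.1 hir) hik
    omega
  refine ⟨hNi, ?_⟩
  rcases hir.eq_or_lt with rfl | hir
  · exact ⟨s, hrs, hsr⟩
  have hi : (x * transp r s * transp j r).1 i = x.1 i := by
    rw [h.apply_move hjr, if_neg hij, if_neg (by omega), if_neg (by omega)]
  rw [hi, h.apply_move hjr] at hk
  split_ifs at hk with h1 h2 h3
  · exact ⟨s, by omega, hk⟩
  -- Position `r` now holds `x j`. If `j` is to the right of `i`, it is a witness in `x`; otherwise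
  -- the cover condition gives `x s < x i`, and `s` is one.
  · rcases lt_or_gt_of_ne hij with h4 | h4
    · exact ⟨j, h4, hk⟩
    · have := hc i h4 hir
      exact ⟨s, by omega, by omega⟩
  · exact ⟨r, hir, hk⟩
  · exact ⟨k, hik, hk⟩

theorem mem_rowsFrom (h : IsMaxTransition x r s) {N : ℕ} (hN : N ≤ r) : r ∈ rowsFrom N x :=
  ⟨hN, s, h.lt, h.apply_lt⟩

/-- If row `j` was nonempty, no fixed point is lost and no row is gained. If it was empty, row `r`
becomes empty; this makes up for the possible new row `j`, or for the loss of the last of the `K`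
fixed points. -/
theorem hasRoom_move (h : IsMaxTransition x r s) {N e j : ℕ} (hN : N ≤ r)
    (hj : Cov (x * transp r s) j r) (hx : HasRoom N e x) :
    HasRoom N e (x * transp r s * transp j r) := by
  obtain ⟨K, hK1, hK2, hK3⟩ := hx
  have hrs := h.lt
  have hsr := h.apply_lt
  obtain ⟨hjr, hjs, hc⟩ := h.cov_left_iff.1 hj
  have hfix : ∀ L, L ≤ K → L ≤ j → ∀ i, i < L → (x * transp r s * transp j r).1 i = i := by
    intro L hL hLj i hi
    rw [h.apply_move hjr, if_neg (by omega), if_neg (by omega), if_neg (by omega)]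
    exact hK1 i (by omega)
  have hsub := fun i => h.rowsFrom_move_subset (i := i) hN hj
  have hfin := finite_rowsFrom N x
  by_cases hrow : ∃ k, j < k ∧ x.1 k < x.1 j
  · obtain ⟨k, hk1, hk2⟩ := hrow
    refine ⟨K, hfix K le_rfl (le_of_inversion hK1 hk1 hk2), ?_, hK3⟩
    have : (rowsFrom N (x * transp r s * transp j r)).ncard ≤ (rowsFrom N x).ncard := by
      refine Set.ncard_le_ncard (fun i hi => ?_) hfin
      by_cases hij : i = j
      · subst hij
        exact ⟨hi.1, k, hk1, hk2⟩
      · exact hsub i hij hi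
    omega
  · have hr : r ∉ rowsFrom N (x * transp r s * transp j r) := by
      rintro ⟨-, k, hk1, hk2⟩
      have hr : (x * transp r s * transp j r).1 r = x.1 j := by
        rw [h.apply_move hjr, if_neg (by omega), if_pos rfl]
      rw [hr, h.apply_move hjr, if_neg (by omega), if_neg (by omega)] at hk2
      split_ifs at hk2 with h1
      · omega
      · exact hrow ⟨k, by omega, hk2⟩
    have hcard := Set.ncard_sdiff_singleton_add_one (h.mem_rowsFrom hN) hfin
    rcases lt_or_ge j K with hjK | hjK
    · refine ⟨K - 1, hfix (K - 1) (by omega) ?_, ?_, by omega⟩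
      -- If `j < K - 1`, the fixed value `K - 1` would lie between `x j = j` and `x s ≥ K`, against
      -- the cover condition.
      · by_contra hlt
        have h1 := hc (K - 1) (by omega) (by omega)
        rw [hK1 _ hjK, hK1 (K - 1) (by omega)] at h1
        have h2 := le_apply hK1 (k := s) (by omega)
        omega
      · have : (rowsFrom N (x * transp r s * transp j r)).ncard ≤ (rowsFrom N x \ {r}).ncard := by
          refine Set.ncard_le_ncard (fun i hi => ⟨?_, ?_⟩) hfin.sdiff
          · refine hsub i ?_ hi
            have := hi.1
            omega
          · rintro rfl
            exact hr hi
        omega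
    · refine ⟨K, hfix K le_rfl hjK, ?_, hK3⟩
      have : (rowsFrom N (x * transp r s * transp j r)).ncard ≤
          (insert j (rowsFrom N x \ {r})).ncard := by
        refine Set.ncard_le_ncard (fun i hi => ?_) (hfin.sdiff.insert j)
        by_cases hij : i = j
        · exact Or.inl hij
        · refine Or.inr ⟨hsub i hij hi, ?_⟩
          rintro rfl
          exact hr hi
      have := Set.ncard_insert_le j (rowsFrom N x \ {r})
      omega

/-- Row `r` is counted, so position `0` is fixed and its value is below `x s`. Among the positions
before `r` with values below `x s`, the one with the largest value gives a cover. -/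
theorem exists_cov (h : IsMaxTransition x r s) {N e : ℕ} (hN : N ≤ r) (hx : HasRoom N e x) :
    ∃ j, Cov (x * transp r s) j r := by
  obtain ⟨K, hK1, hK2, hK3⟩ := hx
  have hpos : 0 < (rowsFrom N x).ncard :=
    (Set.ncard_pos (finite_rowsFrom N x)).2 ⟨r, h.mem_rowsFrom hN⟩
  have hrs := h.lt
  have h0 := hK1 0 (by omega)
  have hKr : K ≤ r := by omega
  have h1 := le_apply hK1 (k := s) (by omega)
  obtain ⟨j, hj, hmax⟩ := Finset.exists_max_image ((Finset.range r).filter fun j => x.1 j < x.1 s)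
    (fun j => x.1 j) ⟨0, by
      rw [Finset.mem_filter, Finset.mem_range]
      omega⟩
  rw [Finset.mem_filter, Finset.mem_range] at hj
  refine ⟨j, h.cov_left_iff.2 ⟨hj.1, hj.2, fun c hc1 hc2 => ?_⟩⟩
  have h2 := apply_ne x c s
  have h3 := apply_ne x c j
  by_contra hcon
  have := hmax c (by
    rw [Finset.mem_filter, Finset.mem_range]
    omega)
  omega

end IsMaxTransition

/-! ### Runs -/

theorem isMTRun_of_boxes {N : ℕ} {x y : SInf} {l : List SInf} (hx : BoxesInFirstRows N x) :
    IsMTRun N x y l ↔ y = x ∧ l = [x] := by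
  constructor
  · rintro ⟨h1, h2, h3, -⟩
    rcases l with _ | ⟨a, _ | ⟨b, l⟩⟩
    · simp at h1
    · simp only [List.head?_cons, Option.some.injEq, List.getLast?_singleton] at h1 h2
      subst h1 h2
      exact ⟨rfl, rfl⟩
    · simp only [List.head?_cons, Option.some.injEq] at h1
      subst h1
      rw [List.isChain_cons_cons] at h3
      exact absurd hx h3.1.1
  · rintro ⟨rfl, rfl⟩
    exact ⟨rfl, rfl, List.IsChain.singleton _, Or.inl hx⟩

theorem isMTRun_of_not_boxes {N : ℕ} {x y : SInf} {l : List SInf} (hx : ¬ BoxesInFirstRows N x)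
    (hmove : ∃ z, IsMTMove x z) :
    IsMTRun N x y l ↔ ∃ z l', IsMTMove x z ∧ IsMTRun N z y l' ∧ l = x :: l' := by
  constructor
  · rintro ⟨h1, h2, h3, h4⟩
    rcases l with _ | ⟨a, _ | ⟨b, l⟩⟩
    · simp at h1
    · simp only [List.head?_cons, Option.some.injEq, List.getLast?_singleton] at h1 h2
      subst h1 h2
      obtain ⟨z, hz⟩ := hmove
      exact absurd hz (h4.resolve_left hx z)
    · simp only [List.head?_cons, Option.some.injEq] at h1
      subst h1
      rw [List.isChain_cons_cons] at h3
      refine ⟨b, b :: l, h3.1.2, ⟨rfl, ?_, h3.2, h4⟩, rfl⟩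
      rwa [List.getLast?_cons_cons] at h2
  · rintro ⟨z, l', hz, ⟨h1, h2, h3, h4⟩, rfl⟩
    rcases l' with _ | ⟨b, l⟩
    · simp at h1
    · simp only [List.head?_cons, Option.some.injEq] at h1
      subst h1
      refine ⟨rfl, ?_, List.isChain_cons_cons.2 ⟨⟨hx, hz⟩, h3⟩, h4⟩
      rwa [List.getLast?_cons_cons]

/-- The last element of a run. -/
noncomputable def runEnd (l : List SInf) : SInf := l.getLast?.getD 1

theorem IsMTRun.runEnd_eq {N : ℕ} {x y : SInf} {l : List SInf} (h : IsMTRun N x y l) :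
    runEnd l = y := by
  rw [runEnd, h.last, Option.getD_some]

/-- The runs from `x` form the finite set `F`; their ends have `e` initial fixed points and
compute the truncated Schubert polynomial. -/
structure RunsExpand (N e : ℕ) (x : SInf) (F : Finset (List SInf)) : Prop where
  mem_iff : ∀ l, l ∈ F ↔ ∃ y, IsMTRun N x y l
  fixed : ∀ l ∈ F, ∀ i, i < e → (runEnd l).1 i = i
  trunc_eq : trunc N (schubert x) = ∑ l ∈ F, schubert (runEnd l)

theorem runsExpand_of_boxes {N e : ℕ} {x : SInf} (hx : BoxesInFirstRows N x) (hr : HasRoom N e x) :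
    RunsExpand N e x {[x]} := by
  refine ⟨fun l => ?_, fun l hl i hi => ?_, ?_⟩
  · rw [Finset.mem_singleton]
    constructor
    · rintro rfl
      exact ⟨x, (isMTRun_of_boxes hx).2 ⟨rfl, rfl⟩⟩
    · rintro ⟨y, hy⟩
      exact ((isMTRun_of_boxes hx).1 hy).2
  · rw [Finset.mem_singleton] at hl
    subst hl
    exact hr.fixed hi
  · rw [Finset.sum_singleton]
    exact trunc_of_vars fun i hi => vars_schubert_lt (boxesInFirstRows_iff.1 hx) hi

open Classical in
-- A run from `x` is `x` followed by a run from the result of a move. Truncation kills the term with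
-- the variable `x_r`, as `r ≥ N`.
theorem IsMaxTransition.runsExpand {x : SInf} {r s : ℕ} (h : IsMaxTransition x r s) {N e : ℕ}
    (hN : N ≤ r) (hx : HasRoom N e x) {F : ℕ → Finset (List SInf)}
    (hF : ∀ j, Cov (x * transp r s) j r → RunsExpand N e (x * transp r s * transp j r) (F j)) :
    RunsExpand N e x (((Finset.range r).filter fun j => Cov (x * transp r s) j r).biUnion
      fun j => (F j).map ⟨List.cons x, List.cons_injective⟩) := by
  have hbox : ¬ BoxesInFirstRows N x := fun hb => by
    have h1 := boxesInFirstRows_iff.1 hb r hN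
    have h2 : x.1 (r + 1) < x.1 r := h.desc.1
    omega
  have hmem : ∀ j, j ∈ (Finset.range r).filter (fun j => Cov (x * transp r s) j r) ↔
      Cov (x * transp r s) j r := fun j => by
    rw [Finset.mem_filter, Finset.mem_range]
    exact ⟨fun hj => hj.2, fun hj => ⟨hj.1, hj⟩⟩
  have hmove : ∃ z, IsMTMove x z := by
    obtain ⟨j, hj⟩ := h.exists_cov hN hx
    exact ⟨_, h.isMTMove_iff.2 ⟨j, hj, rfl⟩⟩
  have hend : ∀ j, Cov (x * transp r s) j r → ∀ l ∈ F j, runEnd (x :: l) = runEnd l := by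
    intro j hj l hl
    obtain ⟨y, hy⟩ := ((hF j hj).mem_iff l).1 hl
    rw [hy.runEnd_eq, ((isMTRun_of_not_boxes hbox hmove).2
      ⟨_, l, h.isMTMove_iff.2 ⟨j, hj, rfl⟩, hy, rfl⟩).runEnd_eq]
  refine ⟨fun l => ?_, fun l hl i hi => ?_, ?_⟩
  · simp only [Finset.mem_biUnion, hmem, Finset.mem_map, Function.Embedding.coeFn_mk]
    constructor
    · rintro ⟨j, hj, l', hl', rfl⟩
      obtain ⟨y, hy⟩ := ((hF j hj).mem_iff l').1 hl'
      exact ⟨y, (isMTRun_of_not_boxes hbox hmove).2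
        ⟨_, l', h.isMTMove_iff.2 ⟨j, hj, rfl⟩, hy, rfl⟩⟩
    · rintro ⟨y, hy⟩
      obtain ⟨z, l', hz, hy', rfl⟩ := (isMTRun_of_not_boxes hbox hmove).1 hy
      obtain ⟨j, hj, rfl⟩ := h.isMTMove_iff.1 hz
      exact ⟨j, hj, l', ((hF j hj).mem_iff l').2 ⟨y, hy'⟩, rfl⟩
  · simp only [Finset.mem_biUnion, hmem, Finset.mem_map, Function.Embedding.coeFn_mk] at hl
    obtain ⟨j, hj, l', hl', rfl⟩ := hl
    rw [hend j hj l' hl']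
    exact (hF j hj).fixed l' hl' i hi
  · rw [h.schubert_eq, map_add, map_mul, trunc_X, if_neg (by omega), zero_mul, zero_add, map_sum,
      Finset.sum_biUnion]
    · refine Finset.sum_congr rfl fun j hj => ?_
      rw [hmem] at hj
      rw [(hF j hj).trunc_eq, Finset.sum_map]
      exact Finset.sum_congr rfl fun l hl => by rw [Function.Embedding.coeFn_mk, hend j hj l hl]
    -- The first permutations of the remaining runs have the values `x j` and `x j'` at `r`, hence
    -- differ.
    · intro j hj j' hj' hne
      rw [Finset.mem_coe, hmem] at hj hj'
      rw [Function.onFun, Finset.disjoint_left]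
      intro l hl hl'
      rw [Finset.mem_map] at hl hl'
      obtain ⟨l1, h1, rfl⟩ := hl
      obtain ⟨l2, h2, h3⟩ := hl'
      obtain rfl : l2 = l1 := List.cons_injective h3
      obtain ⟨y1, hy1⟩ := ((hF j hj).mem_iff _).1 h1
      obtain ⟨y2, hy2⟩ := ((hF j' hj').mem_iff _).1 h2
      have h4 := hy1.head.symm.trans hy2.head
      rw [Option.some.injEq] at h4
      have h5 := congrArg (fun z : SInf => z.1 r) h4
      simp only [h.apply_move hj.1, h.apply_move hj'.1, if_neg (ne_of_gt hj.1),
        if_neg (ne_of_gt hj'.1), if_true] at h5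
      exact hne ((apply_inj x).1 h5)

/-- Runs terminate: a move creates no descent beyond `r` and replaces the value at `r` by `x j < x s
< x r`. The induction is on a bound for the descents, then on this value. -/
theorem exists_runsExpand {N e : ℕ} {x : SInf} (hx : HasRoom N e x) :
    ∃ F, RunsExpand N e x F := by
  obtain ⟨R, hfix⟩ := exists_fixed x
  have hR : ∀ i, R ≤ i → x.1 i < x.1 (i + 1) := fun i hi => by
    rw [hfix i hi, hfix (i + 1) (by omega)]
    omega
  clear hfix
  induction R generalizing x with
  | zero => exact ⟨_, runsExpand_of_boxes (boxesInFirstRows_iff.2 fun i _ => hR i (by omega)) hx⟩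
  | succ r ih =>
    induction hb : x.1 r using Nat.strong_induction_on generalizing x with
    | _ b ihb =>
    by_cases hbox : BoxesInFirstRows N x
    · exact ⟨_, runsExpand_of_boxes hbox hx⟩
    rcases lt_or_desc x r with hd | hd
    · refine ih hx fun i hi => ?_
      rcases hi.eq_or_lt with rfl | hi
      · exact hd
      · exact hR i hi
    · obtain ⟨r', s, h⟩ := exists_isMaxTransition (x := x) ⟨r, hd⟩
      obtain rfl : r' = r := by
        have h1 : r ≤ r' := h.desc.2 hd
        have h2 : x.1 (r' + 1) < x.1 r' := h.desc.1
        by_contra hne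
        have := hR r' (by omega)
        omega
      have hN : N ≤ r' := by
        by_contra hc
        exact hbox (boxesInFirstRows_iff.2 fun i hi => hR i (by omega))
      have key : ∀ j, ∃ F, Cov (x * transp r' s) j r' →
          RunsExpand N e (x * transp r' s * transp j r') F := by
        intro j
        by_cases hj : Cov (x * transp r' s) j r'
        · have hj' := h.cov_left_iff.1 hj
          have hval : (x * transp r' s * transp j r').1 r' = x.1 j := by
            rw [h.apply_move hj.1, if_neg (ne_of_gt hj.1), if_pos rfl]
          have hlt := h.apply_lt
          obtain ⟨F, hF⟩ := ihb (x.1 j) (by omega) (h.hasRoom_move hN hj hx)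
            (fun i hi => h.no_desc_move hj.1 hi) hval
          exact ⟨F, fun _ => hF⟩
        · exact ⟨∅, fun h => absurd h hj⟩
      choose F hF using key
      exact ⟨_, h.runsExpand hN hx hF⟩

/-! ### The diagram determines the permutation -/

/-- At the first difference, `y` would take the value `x i` later than at `i`. This puts the box
`(i, x i)` into the diagram of `y`, but the diagram of `x` never contains it. -/
theorem not_lt_of_diagram_eq {x y : SInf} (h : diagram x = diagram y) {i : ℕ}
    (hi : ∀ k, k < i → x.1 k = y.1 k) : ¬ x.1 i < y.1 i := by
  intro hlt
  obtain ⟨k, hk⟩ := y.1.surjective (x.1 i)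
  have hik : i < k := by
    by_contra hc
    rcases (not_lt.1 hc).eq_or_lt with rfl | hki
    · omega
    · rw [← hi k hki, apply_inj] at hk
      omega
  have hmem : (i, x.1 i) ∈ diagram x := h ▸ ⟨k, hik, hk.trans_lt hlt, hk.symm⟩
  obtain ⟨k', h1, -, h3⟩ := hmem
  have := (apply_inj x).1 h3
  dsimp only at h1
  omega

theorem diagram_injective : Function.Injective diagram := by
  intro x y h
  ext i
  induction i using Nat.strong_induction_on with
  | _ i ih =>
    have h1 := not_lt_of_diagram_eq h ih
    have h2 := not_lt_of_diagram_eq h.symm fun k hk => (ih k hk).symm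
    omega

/-! ### The code -/

theorem code_ne_zero_iff {x : SInf} {i : ℕ} : code x i ≠ 0 ↔ ∃ k, i < k ∧ x.1 k < x.1 i := by
  obtain ⟨n, hn⟩ := exists_fixed x
  have hfin : {j | i < j ∧ x.1 j < x.1 i}.Finite :=
    (Set.finite_lt_nat n).subset fun j hj => inversion_lt hn hj.1 hj.2
  rw [code, Ne, Set.ncard_eq_zero hfin, ← Ne, ← Set.nonempty_iff_ne_empty]
  rfl

theorem bddAbove_code (x : SInf) : BddAbove {k | ∃ i, k = i + 1 ∧ code x i ≠ 0} := by
  obtain ⟨n, hn⟩ := exists_fixed x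
  refine ⟨n, ?_⟩
  rintro _ ⟨i, rfl, hi⟩
  obtain ⟨k, h1, h2⟩ := code_ne_zero_iff.1 hi
  have := inversion_lt hn h1 h2
  omega

theorem lt_codeLength {x : SInf} {i k : ℕ} (hik : i < k) (h : x.1 k < x.1 i) : i < codeLength x :=
  le_csSup (bddAbove_code x) ⟨i, rfl, code_ne_zero_iff.2 ⟨k, hik, h⟩⟩

theorem no_desc_of_codeLength_le {x : SInf} {i : ℕ} (h : codeLength x ≤ i) :
    x.1 i < x.1 (i + 1) := by
  refine (lt_or_desc x i).resolve_right fun hd => ?_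
  have := lt_codeLength (Nat.lt_succ_self i) hd
  omega

theorem desc_codeLength {x : SInf} {m : ℕ} (h : codeLength x = m + 1) : x.1 (m + 1) < x.1 m := by
  have hne : {k | ∃ i, k = i + 1 ∧ code x i ≠ 0}.Nonempty := by
    by_contra hc
    rw [Set.not_nonempty_iff_eq_empty] at hc
    rw [codeLength, hc, csSup_empty] at h
    exact absurd h (Nat.succ_ne_zero m).symm
  obtain ⟨i, hi, hcode⟩ := Nat.sSup_mem hne (bddAbove_code x)
  obtain rfl : m = i := Nat.succ_injective (h.symm.trans hi)
  obtain ⟨k, h1, h2⟩ := code_ne_zero_iff.1 hcode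
  refine (lt_or_desc x m).resolve_left fun hd => ?_
  have h3 : ∀ i, m ≤ i → x.1 i < x.1 (i + 1) := fun i hi => by
    rcases hi.eq_or_lt with rfl | hi
    · exact hd
    · exact no_desc_of_codeLength_le (by omega)
  have := lt_of_no_desc h3 le_rfl h1
  omega

theorem IsGrassmannian.no_desc {x : SInf} (hx : IsGrassmannian x) {i : ℕ}
    (hi : i + 1 < codeLength x) : x.1 i < x.1 (i + 1) := by
  refine (lt_or_desc x i).resolve_right fun hd => ?_
  obtain ⟨m, hm⟩ : ∃ m, codeLength x = m + 1 := ⟨codeLength x - 1, by omega⟩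
  have : i = m := hx hd (desc_codeLength hm)
  omega

theorem ncard_rowsFrom_le_codeLength (x : SInf) : (rowsFrom 0 x).ncard ≤ codeLength x := by
  have : rowsFrom 0 x ⊆ (Finset.range (codeLength x) : Set ℕ) := by
    rintro i ⟨-, k, h1, h2⟩
    rw [Finset.mem_coe, Finset.mem_range]
    exact lt_codeLength h1 h2
  have h := Set.ncard_le_ncard this (Finset.finite_toSet _)
  rwa [Set.ncard_coe_finset, Finset.card_range] at h

theorem ncard_rowsFrom_le_length (x : SInf) : (rowsFrom 0 x).ncard ≤ length x := by
  have : rowsFrom 0 x ⊆ Prod.fst '' inversions x := by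
    rintro i ⟨-, k, h1, h2⟩
    exact ⟨(i, k), ⟨h1, h2⟩, rfl⟩
  exact (Set.ncard_le_ncard this ((finite_inversions x).image _)).trans
    (Set.ncard_image_le (finite_inversions x))

theorem ones_no_desc_of_ge {v : SInf} {m : ℕ} (h : ∀ i, m ≤ i → v.1 i < v.1 (i + 1)) (n : ℕ)
    {i : ℕ} (hi : n + m ≤ i) : (ones n v).1 i < (ones n v).1 (i + 1) := by
  obtain ⟨k, rfl⟩ : ∃ k, i = n + k := ⟨i - n, by omega⟩
  rw [add_assoc, ones_apply_add, ones_apply_add]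
  have := h k (by omega)
  omega

theorem ones_no_desc_of_lt {v : SInf} {m : ℕ} (h : ∀ i, i + 1 < m → v.1 i < v.1 (i + 1)) (n : ℕ)
    {i : ℕ} (hi : i + 1 < n + m) : (ones n v).1 i < (ones n v).1 (i + 1) := by
  rcases lt_or_ge i n with h1 | h1
  · rw [ones_apply_lt v h1, ones_apply]
    split_ifs <;> omega
  · obtain ⟨k, rfl⟩ : ∃ k, i = n + k := ⟨i - n, by omega⟩
    rw [add_assoc, ones_apply_add, ones_apply_add]
    have := h k (by omega)
    omega

/-! ### The permutation `1ⁿ × w × u` -/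

theorem ofFin_apply_ge {p : ℕ} (w : Equiv.Perm (Fin p)) {i : ℕ} (h : p ≤ i) :
    (ofFin w).1 i = i := by
  rw [ofFin, directSum_apply_ge w 1 h, one_apply]
  omega

theorem directSum_eq_mul {p : ℕ} (w : Equiv.Perm (Fin p)) (v : SInf) :
    directSum w v = ofFin w * ones p v := by
  ext i
  rw [mul_apply]
  rcases lt_or_ge i p with h | h
  · rw [ones_apply_lt v h, ofFin, directSum_apply_lt w _ h, directSum_apply_lt w _ h]
  · rw [ones_apply, if_neg (by omega), directSum_apply_ge w v h, ofFin_apply_ge w (by omega)]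

theorem ones_mul (n : ℕ) (a b : SInf) : ones n (a * b) = ones n a * ones n b := by
  ext i
  rw [mul_apply]
  rcases lt_or_ge i n with h | h
  · rw [ones_apply_lt _ h, ones_apply_lt _ h, ones_apply_lt _ h]
  · obtain ⟨k, rfl⟩ : ∃ k, i = n + k := ⟨i - n, by omega⟩
    rw [ones_apply_add, ones_apply_add, ones_apply_add, mul_apply]

theorem schubert_ones_directSum {p : ℕ} (w : Equiv.Perm (Fin p)) (v : SInf) (n : ℕ) :
    schubert (ones n (directSum w v)) = schubert (ones n (ofFin w)) * schubert (ones (n + p) v) := by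
  rw [directSum_eq_mul, ones_mul, ones_ones]
  refine schubert_mul (p := n + p) (fun i hi => ?_) fun i hi => ones_apply_lt v hi
  obtain ⟨k, rfl⟩ : ∃ k, i = n + k := ⟨i - n, by omega⟩
  rw [ones_apply_add, ofFin_apply_ge w (by omega)]

/-- Where the Grassmannian hypothesis enters: `1ⁿ × u` has no descent before position `n + m - 1`,
so stability removes the shift by `p` in the first `n + m` variables. -/
theorem trunc_schubert_ones_directSum {p : ℕ} (w : Equiv.Perm (Fin p)) {u : SInf} {m : ℕ}
    (hw : codeLength (ofFin w) = m) (hu : codeLength u = m) (hG : IsGrassmannian u) (n : ℕ) :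
    trunc (n + m) (schubert (ones n (directSum w u))) =
      schubert (ones n (ofFin w)) * schubert (ones n u) := by
  have h1 : ∀ v : SInf, codeLength v = m →
      trunc (n + m) (schubert (ones n v)) = schubert (ones n v) := fun v hv =>
    trunc_of_vars fun i hi => vars_schubert_lt (fun i hi => ones_no_desc_of_ge
      (fun i hi => no_desc_of_codeLength_le (x := v) (by omega)) n hi) hi
  rw [schubert_ones_directSum, map_mul, h1 _ hw, add_comm n p, ← ones_ones p n,
    trunc_schubert_ones _ p, h1 _ hu]
  exact fun i hi => ones_no_desc_of_lt (fun i hi => hG.no_desc (by omega)) n hi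

/-- The boxes of `w` all lie above row `n + m`, so only shifted rows of `u` are left to be cleared.
-/
theorem rowsFrom_ones_directSum {p : ℕ} (w : Equiv.Perm (Fin p)) (u : SInf) (n : ℕ) :
    rowsFrom (n + codeLength (ofFin w)) (ones n (directSum w u)) ⊆
      (fun i => n + p + i) '' rowsFrom 0 u := by
  rintro i ⟨hi, k, hik, hk⟩
  obtain ⟨a, rfl⟩ : ∃ a, i = n + a := ⟨i - n, by omega⟩
  obtain ⟨b, rfl⟩ : ∃ b, k = n + b := ⟨k - n, by omega⟩
  rw [ones_apply_add, ones_apply_add] at hk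
  rcases lt_or_ge a p with ha | ha
  · have hA : (directSum w u).1 a = (ofFin w).1 a := by
      rw [ofFin, directSum_apply_lt w _ ha, directSum_apply_lt w _ ha]
    have hlt := apply_lt (fun i => ofFin_apply_ge w) ha
    rcases lt_or_ge b p with hb | hb
    · have hB : (directSum w u).1 b = (ofFin w).1 b := by
        rw [ofFin, directSum_apply_lt w _ hb, directSum_apply_lt w _ hb]
      have := lt_codeLength (x := ofFin w) (i := a) (k := b) (by omega) (by omega)
      omega
    · rw [directSum_apply_ge w u hb] at hk
      omega
  · rw [directSum_apply_ge w u ha, directSum_apply_ge w u (by omega)] at hk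
    exact ⟨a - p, ⟨Nat.zero_le _, b - p, by omega, by omega⟩, by dsimp only; omega⟩

theorem hasRoom_ones_directSum {p : ℕ} (w : Equiv.Perm (Fin p)) (u : SInf) {n : ℕ}
    (hn : (rowsFrom 0 u).ncard ≤ n) :
    HasRoom (n + codeLength (ofFin w)) (n - (rowsFrom 0 u).ncard) (ones n (directSum w u)) := by
  refine ⟨n, fun i hi => ones_apply_lt _ hi, ?_, Nat.le_add_right _ _⟩
  have h1 := Set.ncard_le_ncard (rowsFrom_ones_directSum w u n) ((finite_rowsFrom 0 u).image _)
  have h2 := Set.ncard_image_le (f := fun i => n + p + i) (finite_rowsFrom 0 u)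
  omega

/-! ### Coefficients of products -/

/-- Setting `x_0 = 0` kills every term that is not of the form `1 × v'` and strips the `1` off the
others. -/
theorem IsSchubertExpansion.delVar_zero {f : MvPolynomial ℕ ℤ} {c : SInf →₀ ℤ}
    (h : IsSchubertExpansion f c) :
    IsSchubertExpansion (delVar 0 f) (c.comapDomain (ones 1) (ones_injective 1).injOn) := by
  rw [IsSchubertExpansion, h, Finsupp.sum, Finsupp.sum, map_sum]
  simp only [Finsupp.comapDomain_apply, Finsupp.comapDomain_support, map_zsmul]
  rw [← Finset.sum_preimage (ones 1) c.support (ones_injective 1).injOn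
    (fun v => c v • delVar 0 (schubert v))]
  · simp only [delVar_zero_schubert_ones]
  · intro v _ hv
    rw [delVar_zero_schubert_of_ne, smul_zero]
    intro h0
    obtain ⟨v', rfl⟩ := exists_eq_ones (n := 1) (z := v) fun i hi => by
      obtain rfl : i = 0 := by omega
      exact h0
    exact hv ⟨v', rfl⟩

theorem delVar_zero_prod (w u : SInf) (n : ℕ) :
    delVar 0 (schubert (ones (n + 1) w) * schubert (ones (n + 1) u)) =
      schubert (ones n w) * schubert (ones n u) := by
  rw [map_mul, add_comm n 1, ← ones_ones, ← ones_ones, delVar_zero_schubert_ones,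
    delVar_zero_schubert_ones]

theorem RunsExpand.isSchubertExpansion {N e : ℕ} {x : SInf} {F : Finset (List SInf)}
    (h : RunsExpand N e x F) : IsSchubertExpansion (trunc N (schubert x))
      (∑ l ∈ F, Finsupp.single (runEnd l) 1) := by
  rw [IsSchubertExpansion, h.trunc_eq, ← Finsupp.sum_finsetSum_index (by simp)
    (fun _ _ _ => add_smul _ _ _)]
  simp

section Coefficients

variable {p : ℕ} {w : Equiv.Perm (Fin p)} {u : SInf} {m : ℕ}

theorem exists_runsExpand_prod (hw : codeLength (ofFin w) = m) (hu : codeLength u = m)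
    (hG : IsGrassmannian u) {n : ℕ} (hn : (rowsFrom 0 u).ncard ≤ n) :
    ∃ F, RunsExpand (n + m) (n - (rowsFrom 0 u).ncard) (ones n (directSum w u)) F ∧
      prodCoeff (ofFin w) u n = ∑ l ∈ F, Finsupp.single (runEnd l) 1 := by
  have hroom := hasRoom_ones_directSum w u hn
  rw [hw] at hroom
  obtain ⟨F, hF⟩ := exists_runsExpand hroom
  refine ⟨F, hF, ?_⟩
  have := hF.isSchubertExpansion
  rw [trunc_schubert_ones_directSum w hw hu hG n] at this
  exact this.schubertExpansion_eq

theorem prod_isSchubertExpansion (hw : codeLength (ofFin w) = m) (hu : codeLength u = m)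
    (hG : IsGrassmannian u) (n : ℕ) :
    IsSchubertExpansion (schubert (ones n (ofFin w)) * schubert (ones n u))
      (prodCoeff (ofFin w) u n) := by
  -- For large `n` the runs provide an expansion; smaller `n` are reached by repeatedly setting `x_0
  -- = 0`.
  suffices h : ∀ d n, (rowsFrom 0 u).ncard ≤ n + d →
      ∃ c, IsSchubertExpansion (schubert (ones n (ofFin w)) * schubert (ones n u)) c from
    Classical.epsilon_spec (h _ n (Nat.le_add_left _ _))
  intro d
  induction d with
  | zero =>
    intro n hn
    obtain ⟨F, hF, -⟩ := exists_runsExpand_prod hw hu hG (n := n) (by omega)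
    have := hF.isSchubertExpansion
    rw [trunc_schubert_ones_directSum w hw hu hG n] at this
    exact ⟨_, this⟩
  | succ d ih =>
    intro n hn
    obtain ⟨c, hc⟩ := ih (n + 1) (by omega)
    have := hc.delVar_zero
    rw [delVar_zero_prod] at this
    exact ⟨_, this⟩

theorem prodCoeff_succ (hw : codeLength (ofFin w) = m) (hu : codeLength u = m)
    (hG : IsGrassmannian u) (n : ℕ) (v : SInf) :
    prodCoeff (ofFin w) u (n + 1) (ones 1 v) = prodCoeff (ofFin w) u n v := by
  have h1 := (prod_isSchubertExpansion hw hu hG (n + 1)).delVar_zero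
  rw [delVar_zero_prod] at h1
  rw [(prod_isSchubertExpansion hw hu hG n).unique h1, Finsupp.comapDomain_apply]

theorem prodCoeff_add (hw : codeLength (ofFin w) = m) (hu : codeLength u = m)
    (hG : IsGrassmannian u) (n d : ℕ) (v : SInf) :
    prodCoeff (ofFin w) u (n + d) (ones d v) = prodCoeff (ofFin w) u n v := by
  induction d with
  | zero => rw [ones_zero, add_zero]
  | succ d ih => rw [add_comm d 1, ← ones_ones, add_comm 1 d, ← add_assoc,
      prodCoeff_succ hw hu hG, ih]

/-- Here the surplus of fixed points is positive, so all ends of runs fix position `0` and come from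
the previous level. -/
theorem newTerms_eq_empty (hw : codeLength (ofFin w) = m) (hu : codeLength u = m)
    (hG : IsGrassmannian u) {n : ℕ} (hn : (rowsFrom 0 u).ncard < n) :
    newTerms (ofFin w) u n = ∅ := by
  classical
  obtain ⟨n, rfl⟩ : ∃ k, n = k + 1 := ⟨n - 1, by omega⟩
  rw [newTerms, Finset.filter_eq_empty_iff]
  intro v hv hnew
  rw [Finsupp.mem_support_iff] at hv
  obtain ⟨F, hF, hc⟩ := exists_runsExpand_prod hw hu hG hn.le
  have hl : ∃ l ∈ F, runEnd l = v := by
    by_contra! hne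
    apply hv
    rw [hc, Finsupp.finsetSum_apply]
    exact Finset.sum_eq_zero fun l hl => Finsupp.single_eq_of_ne (hne l hl).symm
  obtain ⟨l, hl, rfl⟩ := hl
  obtain ⟨v', hv'⟩ := exists_eq_ones (n := 1) (z := runEnd l) fun i hi =>
    hF.fixed l hl i (by omega)
  refine hnew v' ?_ hv'
  rw [Finsupp.mem_support_iff, ← prodCoeff_succ hw hu hG, ← hv']
  exact hv

theorem exists_newTerm {n : ℕ} {y : SInf} (hy : prodCoeff (ofFin w) u n y ≠ 0) :
    ∃ i ≤ n, ∃ v ∈ newTerms (ofFin w) u i, y = ones (n - i) v := by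
  classical
  induction n generalizing y with
  | zero => exact ⟨0, le_rfl, y, Finsupp.mem_support_iff.2 hy, (ones_zero y).symm⟩
  | succ n ih =>
    by_cases hnew : ∀ v' ∈ (prodCoeff (ofFin w) u n).support, y ≠ ones 1 v'
    · refine ⟨n + 1, le_rfl, y, Finset.mem_filter.2 ⟨Finsupp.mem_support_iff.2 hy, hnew⟩, ?_⟩
      rw [Nat.sub_self, ones_zero]
    · push Not at hnew
      obtain ⟨v', hv', rfl⟩ := hnew
      obtain ⟨i, hi, v, hv, rfl⟩ := ih (Finsupp.mem_support_iff.1 hv')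
      refine ⟨i, by omega, v, hv, ?_⟩
      rw [ones_ones]
      congr 1
      omega

/-- Sorts the expansion at level `n` by the level at which each term first appeared; arbitrary `g`
lets the induction absorb the shift by `ones 1`. -/
theorem sum_prodCoeff {A : Type*} [AddCommGroup A] (hw : codeLength (ofFin w) = m)
    (hu : codeLength u = m) (hG : IsGrassmannian u) (n : ℕ) (g : SInf → A) :
    (prodCoeff (ofFin w) u n).sum (fun v a => a • g v) =
      ∑ i ∈ Finset.range (n + 1), ∑ v ∈ newTerms (ofFin w) u i,
        prodCoeff (ofFin w) u i v • g (ones (n - i) v) := by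
  classical
  induction n generalizing g with
  | zero =>
    rw [zero_add, Finset.sum_range_one]
    simp only [Nat.sub_self, ones_zero]
    rfl
  | succ n ih =>
    rw [Finset.sum_range_succ, Nat.sub_self, Finsupp.sum, ← Finset.sum_filter_not_add_sum_filter
      (p := fun v => ∀ v' ∈ (prodCoeff (ofFin w) u n).support, v ≠ ones 1 v')]
    congr 1
    · have h := ih fun v => g (ones 1 v)
      have h2 : ∀ i ∈ Finset.range (n + 1), ∑ v ∈ newTerms (ofFin w) u i,
          prodCoeff (ofFin w) u i v • g (ones 1 (ones (n - i) v)) =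
          ∑ v ∈ newTerms (ofFin w) u i,
          prodCoeff (ofFin w) u i v • g (ones (n + 1 - i) v) := by
        intro i hi
        rw [Finset.mem_range] at hi
        simp only [ones_ones]
        rw [show 1 + (n - i) = n + 1 - i by omega]
      rw [Finset.sum_congr rfl h2] at h
      rw [← h, Finsupp.sum]
      symm
      refine Finset.sum_bij (fun v _ => ones 1 v) (fun v hv => ?_)
        (fun v _ v' _ h => ones_injective 1 h) (fun v hv => ?_) (fun v _ => ?_)
      · rw [Finset.mem_filter, Finsupp.mem_support_iff, prodCoeff_succ hw hu hG]
        exact ⟨Finsupp.mem_support_iff.1 hv, fun h => h v hv rfl⟩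
      · have := (Finset.mem_filter.1 hv).2
        push Not at this
        obtain ⟨v', h1, h2⟩ := this
        exact ⟨v', h1, h2.symm⟩
      · rw [prodCoeff_succ hw hu hG]
    · simp only [ones_zero]
      refine Finset.sum_congr ?_ fun _ _ => rfl
      ext v
      simp [newTerms]

end Coefficients

/-! ### Stanley symmetric functions -/

/-- The coefficient is already constant from `n = d` on: `1ᵈ × v` has no descent before `d - 1`, so
stability holds in the first `d` variables. -/
theorem coeff_stanley (v : SInf) {e : ℕ →₀ ℕ} {d n : ℕ} (he : ∀ i ∈ e.support, i < d)
    (hn : d ≤ n) : MvPowerSeries.coeff e (stanley v) = MvPolynomial.coeff e (schubert (ones n v)) := by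
  have key : ∀ n, d ≤ n → MvPolynomial.coeff e (schubert (ones n v)) =
      MvPolynomial.coeff e (schubert (ones d v)) := by
    intro n hn
    obtain ⟨p, rfl⟩ : ∃ p, n = p + d := ⟨n - d, by omega⟩
    rw [← coeff_trunc _ he, ← ones_ones, trunc_schubert_ones, coeff_trunc _ he]
    intro i hi
    rw [ones_apply_lt v (by omega), ones_apply_lt v hi]
    omega
  rw [key n hn]
  refine Filter.Tendsto.limUnder_eq (tendsto_const_nhds.congr' ?_)
  filter_upwards [Filter.eventually_ge_atTop d] with n hn
  exact (key n hn).symm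

theorem coeff_stanley_mul (w u : SInf) {e : ℕ →₀ ℕ} {d n : ℕ} (he : ∀ i ∈ e.support, i < d)
    (hn : d ≤ n) : MvPowerSeries.coeff e (stanley w * stanley u) =
      MvPolynomial.coeff e (schubert (ones n w) * schubert (ones n u)) := by
  classical
  rw [MvPowerSeries.coeff_mul, MvPolynomial.coeff_mul]
  refine Finset.sum_congr rfl fun a ha => ?_
  rw [Finset.HasAntidiagonal.mem_antidiagonal] at ha
  rw [coeff_stanley w (d := d) (fun i hi => he i ?_) hn,
    coeff_stanley u (d := d) (fun i hi => he i ?_) hn]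
  · rw [Finsupp.mem_support_iff] at hi ⊢
    rw [← ha, Finsupp.add_apply]
    omega
  · rw [Finsupp.mem_support_iff] at hi ⊢
    rw [← ha, Finsupp.add_apply]
    omega

end SInf

/-! ### The canonical expansion and the multiplicities of the final diagrams. -/

theorem mainTheorem4 {p q : ℕ} (w : Equiv.Perm (Fin p)) (u : Equiv.Perm (Fin q)) (m : ℕ)
    (hw : SInf.codeLength (SInf.ofFin w) = m) (hu : SInf.codeLength (SInf.ofFin u) = m)
    (hG : SInf.IsGrassmannian (SInf.ofFin u)) :
    -- the canonical expansion of `F_w F_u`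
    (SInf.stanley (SInf.ofFin w) * SInf.stanley (SInf.ofFin u) =
      ∑ t ∈ SInf.canonicalTerms (SInf.ofFin w) (SInf.ofFin u),
        SInf.prodCoeff (SInf.ofFin w) (SInf.ofFin u) t.1 t.2 • SInf.stanley t.2) ∧
    -- each coefficient `c_{wu}^v`, `v ∈ V_i`, is the multiplicity of `D(1^{m-i} × v)`
    (∀ t ∈ SInf.canonicalTerms (SInf.ofFin w) (SInf.ofFin u), t.1 ≤ m ∧
      (SInf.mtRunsTo (2 * m) (SInf.ones m (SInf.directSum w (SInf.ofFin u)))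
        (SInf.diagram (SInf.ones (m - t.1) t.2))).Finite ∧
      SInf.prodCoeff (SInf.ofFin w) (SInf.ofFin u) t.1 t.2 =
        ((SInf.mtRunsTo (2 * m) (SInf.ones m (SInf.directSum w (SInf.ofFin u)))
          (SInf.diagram (SInf.ones (m - t.1) t.2))).ncard : ℤ)) ∧
    -- no other diagrams are obtained
    (∀ D : Set (ℕ × ℕ),
      (SInf.mtRunsTo (2 * m) (SInf.ones m (SInf.directSum w (SInf.ofFin u))) D).Nonempty →
      ∃ t ∈ SInf.canonicalTerms (SInf.ofFin w) (SInf.ofFin u),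
        t.1 ≤ m ∧ D = SInf.diagram (SInf.ones (m - t.1) t.2)) := by
  classical
  have hrm : (SInf.rowsFrom 0 (SInf.ofFin u)).ncard ≤ m :=
    hu ▸ SInf.ncard_rowsFrom_le_codeLength (SInf.ofFin u)
  have hrl := SInf.ncard_rowsFrom_le_length (SInf.ofFin u)
  have hle : ∀ i v, v ∈ SInf.newTerms (SInf.ofFin w) (SInf.ofFin u) i →
      i ≤ (SInf.rowsFrom 0 (SInf.ofFin u)).ncard := by
    intro i v hv
    by_contra hc
    rw [SInf.newTerms_eq_empty hw hu hG (not_le.1 hc)] at hv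
    exact absurd hv (Finset.notMem_empty v)
  have hmem : ∀ t : Σ _ : ℕ, SInf, t ∈ SInf.canonicalTerms (SInf.ofFin w) (SInf.ofFin u) ↔
      t.2 ∈ SInf.newTerms (SInf.ofFin w) (SInf.ofFin u) t.1 := by
    intro t
    rw [SInf.canonicalTerms, Finset.mem_sigma, Finset.mem_range]
    refine ⟨fun h => h.2, fun h => ⟨?_, h⟩⟩
    have := hle _ _ h
    omega
  obtain ⟨F, hF, hc⟩ := SInf.exists_runsExpand_prod hw hu hG hrm
  rw [← two_mul] at hF
  have hcoeff : ∀ v, SInf.prodCoeff (SInf.ofFin w) (SInf.ofFin u) m v =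
      ((F.filter fun l => SInf.runEnd l = v).card : ℤ) := by
    intro v
    rw [hc, Finsupp.finsetSum_apply, Finset.card_filter, Nat.cast_sum]
    refine Finset.sum_congr rfl fun l _ => ?_
    rw [Finsupp.single_apply]
    split_ifs <;> rfl
  have hruns : ∀ v, SInf.mtRunsTo (2 * m) (SInf.ones m (SInf.directSum w (SInf.ofFin u)))
      (SInf.diagram v) = ↑(F.filter fun l => SInf.runEnd l = v) := by
    intro v
    ext l
    rw [Finset.mem_coe, Finset.mem_filter, hF.mem_iff]
    constructor
    · rintro ⟨y, hy, hD⟩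
      exact ⟨⟨y, hy⟩, hy.runEnd_eq.trans (SInf.diagram_injective hD)⟩
    · rintro ⟨⟨y, hy⟩, rfl⟩
      exact ⟨y, hy, by rw [hy.runEnd_eq]⟩
  refine ⟨?_, fun t ht => ?_, ?_⟩
  -- At level `d + 1 + k`, every term with `i ≤ k` still begins with at least `d + 1` ones, enough
  -- for its coefficient at `e` to be that of the Stanley function. Levels `i > k` contribute
  -- nothing new.
  · ext e
    obtain ⟨d, hd⟩ := e.support.bddAbove
    have he : ∀ i ∈ e.support, i < d + 1 := fun i hi => Nat.lt_succ_of_le (hd hi)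
    set k := SInf.length (SInf.ofFin w) + SInf.length (SInf.ofFin u) with hk
    rw [SInf.coeff_stanley_mul _ _ he (n := d + 1 + k) (by omega),
      SInf.prod_isSchubertExpansion hw hu hG (d + 1 + k), SInf.sum_prodCoeff hw hu hG,
      SInf.canonicalTerms, Finset.sum_sigma, map_sum, MvPolynomial.coeff_sum, ← hk]
    symm
    refine Finset.sum_subset_zero_on_sdiff (fun i hi => ?_) (fun i hi => ?_) fun i hi => ?_
    · rw [Finset.mem_range] at hi ⊢
      omega
    · rw [Finset.mem_sdiff, Finset.mem_range, Finset.mem_range] at hi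
      rw [SInf.newTerms_eq_empty hw hu hG (by omega), Finset.sum_empty, MvPolynomial.coeff_zero]
    · rw [Finset.mem_range] at hi
      rw [map_sum, MvPolynomial.coeff_sum]
      refine Finset.sum_congr rfl fun v _ => ?_
      rw [map_zsmul, SInf.coeff_stanley v he (n := d + 1 + k - i) (by omega),
        MvPolynomial.coeff_smul]
  · have h := hle _ _ ((hmem t).1 ht)
    -- The coefficient at level `t.1` equals that of `1^{m-i} × v` at level `m`, which counts runs.
    have h1 := SInf.prodCoeff_add hw hu hG t.1 (m - t.1) t.2
    rw [Nat.add_sub_cancel' (h.trans hrm), hcoeff] at h1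
    refine ⟨h.trans hrm, ?_, ?_⟩
    · rw [hruns]
      exact Finset.finite_toSet _
    · rw [hruns, Set.ncard_coe_finset, h1]
  · rintro D ⟨l, y, hy, rfl⟩
    have hne : SInf.prodCoeff (SInf.ofFin w) (SInf.ofFin u) m y ≠ 0 := by
      rw [hcoeff, Nat.cast_ne_zero, ← Nat.pos_iff_ne_zero, Finset.card_pos]
      exact ⟨l, Finset.mem_filter.2 ⟨(hF.mem_iff l).2 ⟨y, hy⟩, hy.runEnd_eq⟩⟩
    obtain ⟨i, hi, v, hv, rfl⟩ := SInf.exists_newTerm hne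
    exact ⟨⟨i, v⟩, (hmem _).2 hv, hi, rfl⟩
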